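/- Running times count steps of exact real arithmetic: an arithmetic operation, a square root, a logarithm, a comparison of reals, or the draw of a uniform random number in $[0,1]$ costs one step; matrices are given by their nonzero entries. $\|\cdot\|_2$ is the operator norm of a matrix and $\lambda_{\min}$ the smallest eigenvalue. **Oracle.** An oracle ApproxminEV with constant $K$ is a randomized procedure (with measurable output) such that for every $n\ge1$, every symmetric $C\in\mathbb R^{n\times n}$ with $\|C\|_2\le\rho$ and at most $N$ nonzero entries, where $N\ge n$, and all $0<\varepsilon\le\rho$, $0<\delta\le\frac12$, it always stops within $K\,\frac{N\sqrt\rho}{\sqrt\varepsilon}\log\frac n\delta$ steps, and with probability at least $1-\delta$ it returns a unit vector $x$ and the number $\lambda=x^TCx$ such that $x^TCx\le\lambda_{\min}(C)+\varepsilon$. **Assumption 1.** $A,B\in\mathbb R^{n\times n}$ are symmetric, $\|A\|_2\le\rho_A\le3\|A\|_2$, $\|B\|_2\le\rho_B\le3\|B\|_2$, $\xi>0$, $\lambda_{\min}(B)\le-\xi$, and there is $\mu\in(0,1]$ with $\mu A+(1-\mu)B\succeq\xi I$. For given $a,b\in\mathbb R^n$ and $d\in\mathbb R$ put $\phi=\rho_A+\rho_B+\|a\|+\|b\|+|d|+1$,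 and let $N$ be the total number of nonzero entries of $A$ and $B$. **Algorithm** PsdPencil$(A,B,\xi,\phi,\delta)$. Put $T=\log_2\frac{8\phi}{\xi}$, $\mu_1=0$, $\mu_2=1$. For $i=1,2,\dots$ while $i\le T$: let $\mu=(\mu_1+\mu_2)/2$; call ApproxminEV (with fresh independent randomness) on $C=\mu A+(1-\mu)B$ with norm bound $\phi$, accuracy $\xi/4$ and failure probability $\delta/T$, obtaining $(\lambda,x)$; if $\lambda\ge3\xi/4$, return $(\mu,\lambda,x)$; otherwise, if $x^TAx>x^TBx$ set $\mu_1=\mu$, else set $\mu_2=\mu$. If the loop ends without returning, report that Assumption 1 fails. **Theorem.** (1) There is an oracle ApproxminEV in the above sense: an explicit procedure (using repeated sparse matrix-vector products on a starting vector that is uniform in $[0,1]^n$), fixed independently of the inputs, has the stated guarantees for some constant $K$. (2) For every $K$ there is a constant $c>0$ such that, for every oracle ApproxminEV with constant $K$, all $A,B,\rho_A,\rho_B,\xi$ satisfying Assumption 1, all $a,b,d$, and all $0<\delta<1$: * PsdPencil always makes at most $\log_2\frac{8\phi}{\xi}$ calls to ApproxminEV. * With probability at least $1-\delta$ it returns $(\mu,\lambda,x)$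 with $\mu\in(0,1]$, $x$ a unit vector, $\lambda=x^T(\mu A+(1-\mu)B)x\ge\frac{3\xi}4$ and $\lambda_{\min}(\mu A+(1-\mu)B)\ge\lambda-\frac\xi4$. * Its total running time, oracle calls included, is always at most $$c\,\frac{N\sqrt\phi}{\sqrt\xi}\,\log\Bigl(\frac n\delta\log\frac{8\phi}\xi\Bigr)\log\frac{8\phi}\xi .$$ * In particular, if $\xi\le\frac14$, it is at most $$c\,(1+\log\phi)^2\,\frac{N\sqrt\phi}{\sqrt\xi}\,\log\Bigl(\frac n\delta\log\frac1\xi\Bigr)\log\frac1\xi ,$$ that is, $O\bigl(\frac{N\sqrt\phi}{\sqrt\xi}\log(\frac n\delta\log\frac1\xi)\log\frac1\xi\bigr)$ up to factors logarithmic in $\phi$. -/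

import Mathlib

open scoped Matrix

noncomputable section

namespace GTRS

/-! ### Step counting

Exact real arithmetic (the real-RAM model): one step for each arithmetic operation, square root,
logarithm, comparison of two real numbers, or draw of a random number from the unit interval.
Matrices are stored as lists of their nonzero entries. -/

/-- A value together with the number of steps spent on computing it. -/
structure Timed (α : Type) where
  val : α
  time : ℕ

instance : Monad Timed where
  pure a := ⟨a, 0⟩
  bind m f := ⟨(f m.val).val, m.time + (f m.val).time⟩

/-- `a`, computed in `c` steps. -/
def charge {α : Type} (c : ℕ) (a : α) : Timed α := ⟨a, c⟩

/-- Spend `c` steps, for instance on evaluating the condition of the next branch. -/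
def tick (c : ℕ) : Timed Unit := ⟨(), c⟩

/-- Run the loop body `f` exactly `k` times. Each pass also pays for testing and incrementing the
loop counter, and the last test is paid for too. -/
def loop {α : Type} (f : α → Timed α) : ℕ → α → Timed α
  | 0, a => charge 1 a
  | k + 1, a => do
      let b ← charge 2 a
      let c ← f b
      loop f k c

/-- Number of nonzero entries. -/
def nnz {n : ℕ} (M : Matrix (Fin n) (Fin n) ℝ) : ℕ :=
  Set.ncard {p : Fin n × Fin n | M p.1 p.2 ≠ 0}

/-- Sparse matrix times vector: the result is cleared, then every nonzero entry costs one
multiplication and one addition. -/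
def spMulVec {n : ℕ} (M : Matrix (Fin n) (Fin n) ℝ) (x : Fin n → ℝ) : Timed (Fin n → ℝ) :=
  charge (2 * nnz M + n) (M *ᵥ x)

/-- The inner product of two vectors. -/
def dot {n : ℕ} (x y : Fin n → ℝ) : Timed ℝ := charge (2 * n) (x ⬝ᵥ y)

/-- The quadratic form `xᵀ M x`. -/
def quadForm {n : ℕ} (M : Matrix (Fin n) (Fin n) ℝ) (x : Fin n → ℝ) : Timed ℝ := do
  let y ← spMulVec M x
  dot x y

/-- `x / ‖x‖₂`. -/
def normalize {n : ℕ} (x : Fin n → ℝ) : Timed (Fin n → ℝ) := do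
  let s ← dot x x
  let r ← charge 2 (1 / √s)
  charge n (r • x)

/-- The sparse matrix `μ A + (1 - μ) B`: one multiplication and at most one addition for every
stored entry of `A` and of `B`. -/
def pencil {n : ℕ} (A B : Matrix (Fin n) (Fin n) ℝ) (μ : ℝ) : Timed (Matrix (Fin n) (Fin n) ℝ) :=
  charge (2 * (nnz A + nnz B) + 1) (μ • A + (1 - μ) • B)

/-! ### Norm and smallest eigenvalue -/

/-- The operator norm `‖M‖₂`. -/
def opNorm {n : ℕ} (M : Matrix (Fin n) (Fin n) ℝ) : ℝ :=
  ‖Matrix.toEuclideanCLM (n := Fin n) (𝕜 := ℝ) M‖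

/-- The smallest eigenvalue (of a symmetric matrix). -/
def lambdaMin {n : ℕ} (M : Matrix (Fin n) (Fin n) ℝ) : ℝ := sInf (spectrum ℝ M)

/-! ### Approximate eigenvector procedures -/

/-- A randomized procedure that, from a symmetric matrix `C` with `‖C‖₂ ≤ ρ` and from parameters
`ε` and `δ`, computes a number and a vector. The random seed of one call on matrices of size `n`
has the distribution `law n`. -/
structure EVProcedure where
  Seed : ℕ → Type
  seedSpace : ∀ n, MeasurableSpace (Seed n)
  law : ∀ n, @MeasureTheory.Measure (Seed n) (seedSpace n)
  isProb : ∀ n, @MeasureTheory.IsProbabilityMeasure (Seed n) (seedSpace n) (law n)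
  run : ∀ {n : ℕ}, Matrix (Fin n) (Fin n) ℝ → (ρ ε δ : ℝ) → Seed n → Timed (ℝ × (Fin n → ℝ))

instance (O : EVProcedure) (n : ℕ) : MeasurableSpace (O.Seed n) := O.seedSpace n

instance (O : EVProcedure) (n : ℕ) : MeasureTheory.IsProbabilityMeasure (O.law n) := O.isProb n

/-- `O` is an approximate smallest-eigenvector oracle with time constant `K`: it always stops
within `K · N √ρ / √ε · log (n / δ)` steps, where `N ≥ n` bounds the number of nonzero entries, and
with probability at least `1 - δ` it returns a unit vector `x` and `λ = xᵀ C x` such that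
`xᵀ C x ≤ λ_min(C) + ε`. -/
def IsApproxMinEV (O : EVProcedure) (K : ℝ) : Prop :=
  ∀ (n N : ℕ) (C : Matrix (Fin n) (Fin n) ℝ) (ρ ε δ : ℝ),
    1 ≤ n → n ≤ N → nnz C ≤ N → C.IsSymm → opNorm C ≤ ρ →
    0 < ε → ε ≤ ρ → 0 < δ → δ ≤ 1 / 2 →
      Measurable (fun s => (O.run C ρ ε δ s).val) ∧
      (∀ s, ((O.run C ρ ε δ s).time : ℝ) ≤ K * (N * √ρ / √ε * Real.log (n / δ))) ∧
      ENNReal.ofReal (1 - δ) ≤ O.law n {s |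
        let lam := (O.run C ρ ε δ s).val.1
        let x := (O.run C ρ ε δ s).val.2
        x ⬝ᵥ x = 1 ∧ lam = x ⬝ᵥ (C *ᵥ x) ∧ x ⬝ᵥ (C *ᵥ x) ≤ lambdaMin C + ε}

/-! ### A concrete oracle

Bisection for the smallest eigenvalue from one random starting vector. Each test applies a
Chebyshev-type polynomial of the matrix to the starting vector. -/

/-- One step of the three-term recurrence
`(p, q) ↦ (q, (4 Y - 2) q - p)` with `Y = (C - t) / (2 ρ)`. -/
def chebStep {n : ℕ} (C : Matrix (Fin n) (Fin n) ℝ) (ρ t : ℝ)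
    (s : (Fin n → ℝ) × (Fin n → ℝ)) : Timed ((Fin n → ℝ) × (Fin n → ℝ)) := do
  let y ← spMulVec C s.2
  charge (6 * n + 1) (s.2, (2 / ρ) • (y - t • s.2) - (2 : ℝ) • s.2 - s.1)

/-- State of the bisection: a lower guess, an upper bound and the current vector. -/
structure EVState (n : ℕ) where
  lo : ℝ
  hi : ℝ
  vec : Fin n → ℝ

/-- One bisection step with random starting vector `v`. The number of passes of the inner loop,
`for j = 0, 1, …` while `j < log (5 n / δ) / √((hi - lo) / (6 ρ))`, needs no rounding operation. -/
def evStep {n : ℕ} (C : Matrix (Fin n) (Fin n) ℝ) (ρ δ : ℝ) (v : Fin n → ℝ) (s : EVState n) :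
    Timed (EVState n) := do
  let g ← charge 1 (s.hi - s.lo)
  let t ← charge 3 (s.lo + 2 * g / 3)
  let κ ← charge 7 (Real.log (5 * n / δ) / √(g / (6 * ρ)))
  let pq ← loop (chebStep C ρ t) ⌈κ⌉₊ (v, v)
  let num ← quadForm C pq.2
  let den ← dot pq.2 pq.2
  tick 2
  if num < t * den then
    let x ← normalize pq.2
    return ⟨s.lo, t, x⟩
  else
    charge 2 ⟨s.lo + g / 3, s.hi, s.vec⟩

/-- The concrete procedure, with starting vector `v`. The outer loop runs
`for j = 0, 1, …` while `j < log (2 ρ / ε) / log (3 / 2)`. -/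
def approxMinEVRun {n : ℕ} (C : Matrix (Fin n) (Fin n) ℝ) (ρ ε δ : ℝ) (v : Fin n → ℝ) :
    Timed (ℝ × (Fin n → ℝ)) := do
  let v ← charge n v
  let x₀ ← normalize v
  let J ← charge 6 (Real.log (2 * ρ / ε) / Real.log (3 / 2))
  let s ← loop (evStep C ρ δ v) ⌈J⌉₊ ⟨-ρ, ρ, x₀⟩
  let lam ← quadForm C s.vec
  return (lam, s.vec)

/-- The concrete oracle: the starting vector has independent coordinates, uniform in `[0, 1]`. -/
def approxMinEV : EVProcedure where
  Seed n := Fin n → unitInterval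
  seedSpace _ := inferInstance
  law _ := MeasureTheory.Measure.pi fun _ => MeasureTheory.volume
  isProb _ := inferInstance
  run C ρ ε δ s := approxMinEVRun C ρ ε δ (fun i => (s i : ℝ))

/-! ### The bisection `PsdPencil` -/

/-- What a run of `PsdPencil` reports: the returned triple `(μ, λ, x)`, or `none` for the message
that the assumption fails, and the number of oracle calls. -/
structure PencilResult (n : ℕ) where
  out : Option (ℝ × ℝ × (Fin n → ℝ))
  calls : ℕ

/-- The loop of `PsdPencil` on the interval `(μ₁, μ₂]` with `k` passes left. Every oracle call uses
a seed of its own: the first one `ω 0`, the next one `ω 1`, and so on. -/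
def psdPencilLoop (O : EVProcedure) {n : ℕ} (A B : Matrix (Fin n) (Fin n) ℝ) (ξ φ δ T : ℝ) :
    ℕ → ℝ → ℝ → (ℕ → O.Seed n) → Timed (PencilResult n)
  | 0, _, _, _ => charge 1 ⟨none, 0⟩
  | k + 1, μ₁, μ₂, ω => do
      let μ ← charge 4 ((μ₁ + μ₂) / 2)
      let C ← pencil A B μ
      let ε ← charge 1 (ξ / 4)
      let δ' ← charge 1 (δ / T)
      let r ← O.run C φ ε δ' (ω 0)
      let lam := r.1
      let x := r.2
      tick 3
      if 3 * ξ / 4 ≤ lam then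
        return ⟨some (μ, lam, x), 1⟩
      else
        let qA ← quadForm A x
        let qB ← quadForm B x
        tick 1
        let rest ← psdPencilLoop O A B ξ φ δ T k (if qB < qA then μ else μ₁)
          (if qB < qA then μ₂ else μ) (fun i => ω (i + 1))
        return ⟨rest.out, rest.calls + 1⟩

/-- `PsdPencil(A, B, ξ, φ, δ)`: the loop `for i = 1, 2, …` while `i ≤ T`, where
`T = log₂ (8 φ / ξ)`, started on `(0, 1]`. -/
def psdPencil (O : EVProcedure) {n : ℕ} (A B : Matrix (Fin n) (Fin n) ℝ) (ξ φ δ : ℝ)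
    (ω : ℕ → O.Seed n) : Timed (PencilResult n) := do
  let T ← charge 5 (Real.logb 2 (8 * φ / ξ))
  psdPencilLoop O A B ξ φ δ T ⌊T⌋₊ 0 1 ω

/-- The standing assumption on the symmetric matrices `A` and `B`. -/
structure StandingAssumption {n : ℕ} (A B : Matrix (Fin n) (Fin n) ℝ) (ρA ρB ξ : ℝ) : Prop where
  symmA : A.IsSymm
  symmB : B.IsSymm
  normA_le : opNorm A ≤ ρA
  le_normA : ρA ≤ 3 * opNorm A
  normB_le : opNorm B ≤ ρB
  le_normB : ρB ≤ 3 * opNorm B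
  xi_pos : 0 < ξ
  minB : lambdaMin B ≤ -ξ
  exists_mu : ∃ μ : ℝ, 0 < μ ∧ μ ≤ 1 ∧ (μ • A + (1 - μ) • B - ξ • 1).PosSemidef

end GTRS

end

/-!
**The oracle.** In the orthonormal eigenbasis of `C` the inner loop multiplies the coordinate that
belongs to the eigenvalue `l` by `V_k (2 y - 1)`, where `y = (l - t) / (2 ρ)` and `V_k` is the
Chebyshev polynomial of the third kind (`eigCoord_loop_chebStep`). The substitutions `y = cos² α`
and `y = -sinh² β` show that `y V_k²` is at most `1` on `[0, 1]`, and that `-y V_k²` grows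
exponentially in `k s` below `-s²` (`mul_chebThird_sq_le_one`,
`sinh_sq_le_neg_mul_chebThird_sq`). Hence, if the vector `q` produced by the loop has a Rayleigh
quotient of at least `t` although the smallest eigenvalue lies well below `t`, then the starting
vector has an unusually small component along a lowest eigenvector
(`sub_le_lambdaMin_of_test`). A starting vector uniform in the cube has such a small component
with probability at most `δ`, uniformly over all tests, because some coordinate of a unit vector is
at least `1 / √n` (`pi_abs_dotProduct_le`). Outside this event the bisection keeps the smallest
eigenvalue above `lo` and the Rayleigh quotient of its vector below `hi` (`EVInvariant`). The gap
shrinks by the factor `2 / 3` in every step and the cost of a step is proportional to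
`gap ^ (-1/2)`, so the costs form a geometric sum dominated by the last step
(`loop_evStep_time_le`).

**The pencil.** Let `ν` be a parameter with `ν A + (1 - ν) B ⪰ ξ I`. If a unit vector `x` has
quadratic form less than `3 ξ / 4` at `μ`, linearity in the parameter gives
`ξ / 4 < (ν - μ) (xᵀ A x - xᵀ B x)`: the sign of the second factor tells on which side of `μ` the
parameter `ν` lies, and `|ν - μ| > ξ / (4 φ)` (`PencilBounds.lt_of_quadForm_lt`). As long as the
oracle answers correctly, the interval therefore contains `ν` and is longer than `ξ / (4 φ)`, so
that the loop must return within `log₂ (8 φ / ξ)` halvings. The seed of a call is independent of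
the later ones (`infinitePi_head_tail`), so the failure probabilities `δ / T` add up to at most `δ`
although the matrices queried depend on earlier answers (`PencilBounds.fail_measure_le`). The
running time is the number of passes times the cost of a call, and what remains is a comparison
of logarithms (`total_time_le`, `log_mul_log_le`).
-/

namespace GTRS

/-! ### Values and running times of the basic operations -/

@[simp] theorem Timed.val_pure {α : Type} (a : α) : (pure a : Timed α).val = a := rfl

@[simp] theorem Timed.time_pure {α : Type} (a : α) : (pure a : Timed α).time = 0 := rfl

@[simp] theorem Timed.val_bind {α β : Type} (m : Timed α) (f : α → Timed β) :
    (m >>= f).val = (f m.val).val := rfl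

@[simp] theorem Timed.time_bind {α β : Type} (m : Timed α) (f : α → Timed β) :
    (m >>= f).time = m.time + (f m.val).time := rfl

@[simp] theorem val_charge {α : Type} (c : ℕ) (a : α) : (charge c a).val = a := rfl

@[simp] theorem time_charge {α : Type} (c : ℕ) (a : α) : (charge c a).time = c := rfl

@[simp] theorem time_tick (c : ℕ) : (tick c).time = c := rfl

theorem loop_val {α : Type} (f : α → Timed α) (k : ℕ) (a : α) :
    (loop f k a).val = (fun b => (f b).val)^[k] a := by
  induction k generalizing a with
  | zero => rfl
  | succ k ih => simp [loop, ih]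

theorem loop_time_of_const {α : Type} {f : α → Timed α} {c : ℕ} (hf : ∀ a, (f a).time = c)
    (k : ℕ) (a : α) : (loop f k a).time = k * (c + 2) + 1 := by
  induction k generalizing a with
  | zero => simp [loop]
  | succ k ih => simp [loop, ih, hf]; ring

section Vectors

variable {n : ℕ} (M : Matrix (Fin n) (Fin n) ℝ) (x y : Fin n → ℝ)

@[simp] theorem spMulVec_val : (spMulVec M x).val = M *ᵥ x := rfl

@[simp] theorem spMulVec_time : (spMulVec M x).time = 2 * nnz M + n := rfl

@[simp] theorem dot_time : (dot x y).time = 2 * n := rfl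

@[simp] theorem quadForm_val : (quadForm M x).val = x ⬝ᵥ (M *ᵥ x) := rfl

@[simp] theorem quadForm_time : (quadForm M x).time = 2 * nnz M + 3 * n := by
  simp [quadForm]; ring

@[simp] theorem normalize_val : (normalize x).val = (1 / √(x ⬝ᵥ x)) • x := rfl

@[simp] theorem normalize_time : (normalize x).time = 3 * n + 2 := by
  simp [normalize]; ring

variable {x} in
theorem normalize_dotProduct_self (hx : x ≠ 0) :
    ((1 / √(x ⬝ᵥ x)) • x) ⬝ᵥ ((1 / √(x ⬝ᵥ x)) • x) = 1 := by
  have h : 0 < x ⬝ᵥ x := lt_of_le_of_ne (by simpa using dotProduct_star_self_nonneg x)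
    (fun h => hx (dotProduct_self_eq_zero.mp h.symm))
  rw [smul_dotProduct, dotProduct_smul, smul_eq_mul, smul_eq_mul, ← mul_assoc, div_mul_div_comm,
    Real.mul_self_sqrt h.le]
  field_simp

end Vectors

/-! ### Eigenvector coordinates, the operator norm and the smallest eigenvalue -/

section Spectral

variable {n : ℕ} {C : Matrix (Fin n) (Fin n) ℝ}

theorem isHermitian_of_isSymm (h : C.IsSymm) : C.IsHermitian := by
  rw [Matrix.IsHermitian, Matrix.conjTranspose_eq_transpose_of_trivial]; exact h

/-- The coordinate of `x` along the `i`-th vector of the orthonormal eigenbasis of `C`. -/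
noncomputable def eigCoord (hC : C.IsHermitian) (i : Fin n) (x : Fin n → ℝ) : ℝ :=
  (hC.eigenvectorBasis i).ofLp ⬝ᵥ x

theorem eigCoord_mulVec (hC : C.IsHermitian) (i : Fin n) (x : Fin n → ℝ) :
    eigCoord hC i (C *ᵥ x) = hC.eigenvalues i * eigCoord hC i x := by
  have hs : Cᵀ = C := by
    rw [← Matrix.conjTranspose_eq_transpose_of_trivial]; exact hC
  have h := hC.mulVec_eigenvectorBasis i
  rw [eigCoord, eigCoord, Matrix.dotProduct_mulVec, ← Matrix.mulVec_transpose, hs, h,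
    smul_dotProduct, smul_eq_mul]

theorem eigCoord_sub (hC : C.IsHermitian) (i : Fin n) (x y : Fin n → ℝ) :
    eigCoord hC i (x - y) = eigCoord hC i x - eigCoord hC i y := dotProduct_sub ..

theorem eigCoord_smul (hC : C.IsHermitian) (i : Fin n) (r : ℝ) (x : Fin n → ℝ) :
    eigCoord hC i (r • x) = r * eigCoord hC i x := by simp [eigCoord]

theorem inner_toLp (x y : Fin n → ℝ) :
    inner ℝ (WithLp.toLp 2 x) (WithLp.toLp 2 y) = x ⬝ᵥ y := by
  simp [EuclideanSpace.inner_toLp_toLp, dotProduct_comm]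

/-- Parseval's identity for the eigenbasis. -/
theorem dotProduct_eq_sum_eigCoord (hC : C.IsHermitian) (x y : Fin n → ℝ) :
    x ⬝ᵥ y = ∑ i, eigCoord hC i x * eigCoord hC i y := by
  rw [← inner_toLp, ← hC.eigenvectorBasis.sum_inner_mul_inner]
  refine Finset.sum_congr rfl fun i _ => ?_
  have key : ∀ z, inner ℝ (hC.eigenvectorBasis i) (WithLp.toLp 2 z) = eigCoord hC i z :=
    fun z => inner_toLp _ z
  rw [real_inner_comm, key, key]

theorem eigenvectorBasis_dotProduct_self (hC : C.IsHermitian) (i : Fin n) :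
    (hC.eigenvectorBasis i).ofLp ⬝ᵥ (hC.eigenvectorBasis i).ofLp = 1 := by
  rw [← inner_toLp]
  simp

theorem exists_eigenvalues_eq_lambdaMin (hC : C.IsHermitian) (hn : 1 ≤ n) :
    ∃ i, hC.eigenvalues i = lambdaMin C := by
  have hne : (spectrum ℝ C).Nonempty := ⟨_, hC.eigenvalues_mem_spectrum_real ⟨0, hn⟩⟩
  have h := hne.csInf_mem C.finite_real_spectrum
  rw [hC.spectrum_real_eq_range_eigenvalues] at h
  obtain ⟨i, hi⟩ := h
  exact ⟨i, by rw [hi, lambdaMin, hC.spectrum_real_eq_range_eigenvalues]⟩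

theorem abs_dotProduct_mulVec_le (C : Matrix (Fin n) (Fin n) ℝ) (x : Fin n → ℝ) :
    |x ⬝ᵥ (C *ᵥ x)| ≤ opNorm C * (x ⬝ᵥ x) := by
  have h1 := abs_real_inner_le_norm (WithLp.toLp 2 x) (WithLp.toLp 2 (C *ᵥ x))
  have h2 := (Matrix.toEuclideanCLM (n := Fin n) (𝕜 := ℝ) C).le_opNorm (WithLp.toLp 2 x)
  rw [Matrix.toEuclideanCLM_toLp] at h2
  rw [inner_toLp] at h1
  have h3 : x ⬝ᵥ x = ‖WithLp.toLp 2 x‖ * ‖WithLp.toLp 2 x‖ := by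
    rw [← inner_toLp, real_inner_self_eq_norm_mul_norm]
  rw [h3, opNorm]
  nlinarith [norm_nonneg (WithLp.toLp 2 x)]

theorem abs_eigenvalues_le (hC : C.IsHermitian) (i : Fin n) : |hC.eigenvalues i| ≤ opNorm C := by
  have h := abs_dotProduct_mulVec_le C (hC.eigenvectorBasis i).ofLp
  rw [hC.mulVec_eigenvectorBasis, dotProduct_smul, eigenvectorBasis_dotProduct_self] at h
  simpa using h

theorem abs_lambdaMin_le (hC : C.IsHermitian) (hn : 1 ≤ n) : |lambdaMin C| ≤ opNorm C := by
  obtain ⟨i, hi⟩ := exists_eigenvalues_eq_lambdaMin hC hn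
  exact hi ▸ abs_eigenvalues_le hC i

theorem exists_inv_sqrt_le_abs (hn : 1 ≤ n) {u : Fin n → ℝ} (hu : u ⬝ᵥ u = 1) :
    ∃ j, 1 / √(n : ℝ) ≤ |u j| := by
  have hn' : (0 : ℝ) < n := by exact_mod_cast hn
  by_contra! h
  have h2 : ∀ j, u j * u j < 1 / n := fun j => by
    have := mul_self_lt_mul_self (abs_nonneg _) (h j)
    rwa [abs_mul_abs_self, div_mul_div_comm, Real.mul_self_sqrt hn'.le, one_mul] at this
  have : u ⬝ᵥ u < ∑ _j : Fin n, 1 / (n : ℝ) :=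
    Finset.sum_lt_sum_of_nonempty ⟨⟨0, hn⟩, Finset.mem_univ _⟩ fun j _ => h2 j
  rw [hu] at this
  simp [hn'.ne'] at this

end Spectral

/-! ### Chebyshev polynomials of the third kind -/

/-- The Chebyshev polynomials of the third kind, `V₀ = 1`, `V₁ = 2 z - 1` and
`V_{k+2} = 2 z V_{k+1} - V_k`. They satisfy `V_k (cos 2α) cos α = cos ((2k+1) α)`. -/
noncomputable def chebThird (z : ℝ) : ℕ → ℝ
  | 0 => 1
  | 1 => 2 * z - 1
  | k + 2 => 2 * z * chebThird z (k + 1) - chebThird z k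

/-- The recurrence from index `0` on: with truncated subtraction `k - 1` this is the convention
`V_{-1} = V_0 = 1`, which is how the starting pair `(v, v)` of the procedure encodes it. -/
theorem chebThird_succ (z : ℝ) (k : ℕ) :
    chebThird z (k + 1) = 2 * z * chebThird z k - chebThird z (k - 1) := by
  cases k with
  | zero => simp [chebThird]
  | succ k => rfl

theorem chebThird_cos (α : ℝ) (k : ℕ) :
    chebThird (Real.cos (2 * α)) k * Real.cos α = Real.cos ((2 * k + 1) * α) := by
  induction k using Nat.twoStepInduction with
  | zero => simp [chebThird]
  | one =>
    have h : (2 * ((1 : ℕ) : ℝ) + 1) * α = 2 * α + α := by push_cast; ring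
    rw [chebThird, h, Real.cos_add, Real.sin_two_mul, Real.cos_two_mul]
    linear_combination (2 * Real.cos α) * Real.sin_sq_add_cos_sq α
  | more k h0 h1 =>
    have e0 : (2 * (k : ℝ) + 1) * α = (2 * ((k + 1 : ℕ) : ℝ) + 1) * α - 2 * α := by
      push_cast; ring
    have e2 : (2 * ((k + 2 : ℕ) : ℝ) + 1) * α = (2 * ((k + 1 : ℕ) : ℝ) + 1) * α + 2 * α := by
      push_cast; ring
    rw [e0, Real.cos_sub] at h0
    rw [chebThird, e2, Real.cos_add]
    linear_combination 2 * Real.cos (2 * α) * h1 - h0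

theorem chebThird_neg_cosh (β : ℝ) (k : ℕ) :
    chebThird (-Real.cosh (2 * β)) k * Real.sinh β = (-1) ^ k * Real.sinh ((2 * k + 1) * β) := by
  induction k using Nat.twoStepInduction with
  | zero => simp [chebThird]
  | one =>
    have h : (2 * ((1 : ℕ) : ℝ) + 1) * β = 2 * β + β := by push_cast; ring
    rw [chebThird, h, Real.sinh_add, Real.sinh_two_mul, Real.cosh_two_mul]
    linear_combination (2 * Real.sinh β - Real.sinh β) * Real.cosh_sq β
  | more k h0 h1 =>
    have e0 : (2 * (k : ℝ) + 1) * β = (2 * ((k + 1 : ℕ) : ℝ) + 1) * β - 2 * β := by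
      push_cast; ring
    have e2 : (2 * ((k + 2 : ℕ) : ℝ) + 1) * β = (2 * ((k + 1 : ℕ) : ℝ) + 1) * β + 2 * β := by
      push_cast; ring
    rw [e0, Real.sinh_sub] at h0
    rw [chebThird, e2, Real.sinh_add]
    linear_combination (-2 * Real.cosh (2 * β)) * h1 - h0

/-- On `[0, 1]` the weighted polynomial is bounded, by the substitution `y = cos² α`. -/
theorem mul_chebThird_sq_le_one {y : ℝ} (h0 : 0 ≤ y) (h1 : y ≤ 1) (k : ℕ) :
    y * chebThird (2 * y - 1) k ^ 2 ≤ 1 := by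
  have hc : Real.cos (Real.arccos √y) = √y :=
    Real.cos_arccos (by linarith [Real.sqrt_nonneg y]) (Real.sqrt_le_one.mpr h1)
  have h := chebThird_cos (Real.arccos √y) k
  rw [Real.cos_two_mul, hc, Real.sq_sqrt h0] at h
  calc y * chebThird (2 * y - 1) k ^ 2 = (chebThird (2 * y - 1) k * √y) ^ 2 := by
        rw [mul_pow, Real.sq_sqrt h0]; ring
    _ ≤ 1 := by rw [h]; exact Real.cos_sq_le_one _

theorem half_le_arsinh {s : ℝ} (h0 : 0 ≤ s) (h1 : s ≤ 1) : s / 2 ≤ Real.arsinh s := by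
  rw [← Real.sinh_le_sinh, Real.sinh_arsinh, Real.sinh_eq]
  have e1 := (abs_le.mp (Real.abs_exp_sub_one_le (x := s / 2)
    (by rw [abs_of_nonneg (by linarith)]; linarith))).2
  rw [abs_of_nonneg (by linarith)] at e1
  have e2 := Real.add_one_le_exp (-(s / 2))
  linarith

/-- Below `-s²` the weighted polynomial grows exponentially in `k s`, by the substitution
`y = -sinh² β`. -/
theorem sinh_sq_le_neg_mul_chebThird_sq {y s : ℝ} (h0 : 0 ≤ s) (h1 : s ≤ 1) (hy : y ≤ -s ^ 2)
    (k : ℕ) : Real.sinh (k * s) ^ 2 ≤ -y * chebThird (2 * y - 1) k ^ 2 := by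
  have hy0 : 0 ≤ -y := by nlinarith [sq_nonneg s]
  set β := Real.arsinh √(-y) with hβ
  have hs : Real.sinh β = √(-y) := Real.sinh_arsinh _
  have h := chebThird_neg_cosh β k
  have hz : -Real.cosh (2 * β) = 2 * y - 1 := by
    have := Real.sq_sqrt hy0
    rw [Real.cosh_two_mul, Real.cosh_sq, hs, this]; ring
  rw [hz, hs] at h
  have e : -y * chebThird (2 * y - 1) k ^ 2 = Real.sinh ((2 * k + 1) * β) ^ 2 := by
    calc _ = (chebThird (2 * y - 1) k * √(-y)) ^ 2 := by
          rw [mul_pow, Real.sq_sqrt hy0]; ring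
      _ = _ := by rw [h, mul_pow, ← pow_mul, mul_comm k 2, pow_mul]; norm_num
  have hβs : s / 2 ≤ β := by
    refine (half_le_arsinh h0 h1).trans (Real.arsinh_le_arsinh.mpr ?_)
    exact Real.le_sqrt_of_sq_le (by linarith)
  rw [e]
  have hk : (0 : ℝ) ≤ k := Nat.cast_nonneg k
  refine pow_le_pow_left₀ (Real.sinh_nonneg_iff.mpr (by positivity)) ?_ 2
  rw [Real.sinh_le_sinh]
  nlinarith

/-! ### One test of the bisection -/

section Test

variable {n : ℕ} {C : Matrix (Fin n) (Fin n) ℝ}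

/-- The inner loop multiplies every eigenvector coordinate by a Chebyshev polynomial of the
eigenvalue. The first component is needed for the induction only. -/
theorem eigCoord_loop_chebStep (hC : C.IsHermitian) {ρ : ℝ} (hρ : 0 < ρ) (t : ℝ) (v : Fin n → ℝ)
    (i : Fin n) (k : ℕ) :
    eigCoord hC i (loop (chebStep C ρ t) k (v, v)).val.1 =
        chebThird (2 * ((hC.eigenvalues i - t) / (2 * ρ)) - 1) (k - 1) * eigCoord hC i v ∧
      eigCoord hC i (loop (chebStep C ρ t) k (v, v)).val.2 =
        chebThird (2 * ((hC.eigenvalues i - t) / (2 * ρ)) - 1) k * eigCoord hC i v := by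
  simp only [loop_val]
  induction k with
  | zero => simp [chebThird]
  | succ k ih =>
    rw [Function.iterate_succ_apply', chebThird_succ]
    generalize (fun b => (chebStep C ρ t b).val)^[k] (v, v) = s at ih
    refine ⟨ih.2, ?_⟩
    simp only [chebStep, Timed.val_bind, val_charge, spMulVec_val, eigCoord_sub, eigCoord_smul,
      eigCoord_mulVec, ih.1, ih.2]
    field_simp

/-- The logarithm in the number of passes makes the amplification factor exceed `2 n / δ`. -/
theorem two_mul_lt_sinh_log {n δ : ℝ} (hn : 1 ≤ n) (hδ : 0 < δ) (hδ' : δ ≤ 1 / 2) :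
    2 * n / δ < Real.sinh (Real.log (5 * n / δ)) := by
  have hE : 10 ≤ 5 * n / δ := by
    rw [le_div_iff₀ hδ]; nlinarith
  rw [Real.sinh_eq, Real.exp_neg, Real.exp_log (by linarith)]
  have h : 2 * n / δ = 2 / 5 * (5 * n / δ) := by ring
  have h2 : (5 * n / δ)⁻¹ ≤ 1 := inv_le_one_of_one_le₀ (by linarith)
  rw [h]
  linarith

/-- If the test of a bisection step fails, then `t - g / 3` is a lower bound of the spectrum,
provided that the starting vector has a component of size `δ / (2 √n)` along a lowest
eigenvector: otherwise this component, amplified by the Chebyshev polynomial, would dominate the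
bounded contribution of the eigenvalues above `t`. -/
theorem sub_le_lambdaMin_of_test (hC : C.IsHermitian) (hn : 1 ≤ n) {ρ t g δ : ℝ} (hρ : 0 < ρ)
    (hCρ : opNorm C ≤ ρ) (ht : -ρ ≤ t) (hg : 0 < g) (hg' : g ≤ 2 * ρ)
    (hδ : 0 < δ) (hδ' : δ ≤ 1 / 2) {i : Fin n} (hi : hC.eigenvalues i = lambdaMin C)
    {v : Fin n → ℝ} (hv : v ⬝ᵥ v ≤ n) (hvi : δ / (2 * √n) ≤ |eigCoord hC i v|)
    {k : ℕ} (hk : Real.log (5 * n / δ) / √(g / (6 * ρ)) ≤ k)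
    (htest : t * ((loop (chebStep C ρ t) k (v, v)).val.2 ⬝ᵥ
        (loop (chebStep C ρ t) k (v, v)).val.2) ≤
      (loop (chebStep C ρ t) k (v, v)).val.2 ⬝ᵥ
        (C *ᵥ (loop (chebStep C ρ t) k (v, v)).val.2)) :
    t - g / 3 ≤ lambdaMin C := by
  by_contra! hlt
  have hn' : (1 : ℝ) ≤ n := by exact_mod_cast hn
  have hq := fun j => (eigCoord_loop_chebStep hC hρ t v j k).2
  generalize (loop (chebStep C ρ t) k (v, v)).val.2 = q at hq htest
  set y : Fin n → ℝ := fun j => (hC.eigenvalues j - t) / (2 * ρ) with hy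
  set V : Fin n → ℝ := fun j => chebThird (2 * y j - 1) k with hV
  set w : Fin n → ℝ := fun j => eigCoord hC j v with hw
  have hsum : 0 ≤ ∑ j, y j * V j ^ 2 * w j ^ 2 := by
    rw [dotProduct_eq_sum_eigCoord hC, dotProduct_eq_sum_eigCoord hC, Finset.mul_sum,
      ← sub_nonneg, ← Finset.sum_sub_distrib] at htest
    have : ∑ j, y j * V j ^ 2 * w j ^ 2 = (∑ j, (eigCoord hC j q * eigCoord hC j (C *ᵥ q) -
        t * (eigCoord hC j q * eigCoord hC j q))) / (2 * ρ) := by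
      rw [Finset.sum_div]
      refine Finset.sum_congr rfl fun j _ => ?_
      rw [eigCoord_mulVec, hq j]
      simp only [hy, hV, hw]
      ring
    rw [this]
    positivity
  have hs0 : 0 < g / (6 * ρ) := by positivity
  have hs1 : √(g / (6 * ρ)) ≤ 1 := by
    rw [Real.sqrt_le_one, div_le_one (by positivity)]; linarith
  have hspos : 0 < √(g / (6 * ρ)) := Real.sqrt_pos.mpr hs0
  have hyi : y i ≤ -√(g / (6 * ρ)) ^ 2 := by
    rw [Real.sq_sqrt hs0.le]
    simp only [hy, hi]
    rw [div_le_iff₀ (by positivity)]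
    have : -(g / (6 * ρ)) * (2 * ρ) = -(g / 3) := by field_simp; norm_num
    rw [this]; linarith
  have hks : Real.log (5 * n / δ) ≤ k * √(g / (6 * ρ)) := by
    rwa [div_le_iff₀ hspos] at hk
  have hbig : (n : ℝ) < -(y i * V i ^ 2 * w i ^ 2) := by
    have h1 := two_mul_lt_sinh_log hn' hδ hδ'
    have h2 : 2 * n / δ < Real.sinh (k * √(g / (6 * ρ))) :=
      h1.trans_le (Real.sinh_le_sinh.mpr hks)
    have h3 := sinh_sq_le_neg_mul_chebThird_sq hspos.le hs1 hyi k
    have h4 : (2 * n / δ) ^ 2 < -y i * V i ^ 2 :=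
      (pow_lt_pow_left₀ h2 (by positivity) two_ne_zero).trans_le h3
    have h5 : (δ / (2 * √n)) ^ 2 ≤ w i ^ 2 := by
      rw [← sq_abs (w i)]; exact pow_le_pow_left₀ (by positivity) hvi 2
    have h6 : 0 < (δ / (2 * √n)) ^ 2 := by
      have : 0 < √(n : ℝ) := Real.sqrt_pos.mpr (by linarith)
      positivity
    -- the amplification `2 n / δ` exactly compensates for the lower bound of the component
    calc (n : ℝ) = (2 * n / δ) ^ 2 * (δ / (2 * √n)) ^ 2 := by
          rw [div_pow, div_pow, mul_pow, mul_pow, Real.sq_sqrt (by linarith)]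
          field_simp
      _ < -y i * V i ^ 2 * w i ^ 2 := by
          refine mul_lt_mul h4 h5 h6 ?_
          exact le_trans (by positivity) h4.le
      _ = _ := by ring
  have hle : ∀ j, y j * V j ^ 2 * w j ^ 2 ≤ w j ^ 2 := by
    intro j
    have hj1 : y j ≤ 1 := by
      simp only [hy]
      rw [div_le_one (by positivity)]
      linarith [(abs_le.mp ((abs_eigenvalues_le hC j).trans hCρ)).2]
    have : y j * V j ^ 2 ≤ 1 := by
      rcases le_total 0 (y j) with h | h
      · exact mul_chebThird_sq_le_one h hj1 k
      · nlinarith [sq_nonneg (V j)]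
    nlinarith [sq_nonneg (w j)]
  have hw2 : ∑ j, w j ^ 2 ≤ n := by
    refine le_trans (le_of_eq ?_) hv
    rw [dotProduct_eq_sum_eigCoord hC]
    exact Finset.sum_congr rfl fun j _ => sq _
  rw [← Finset.add_sum_erase _ _ (Finset.mem_univ i)] at hsum hw2
  have := Finset.sum_le_sum fun j (_ : j ∈ Finset.univ.erase i) => hle j
  nlinarith [sq_nonneg (w i)]

end Test

/-! ### The random starting vector -/

section Random

open MeasureTheory

theorem volume_abs_mul_add_le {u : ℝ} (hu : u ≠ 0) (c τ : ℝ) :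
    volume {s : unitInterval | |u * (s : ℝ) + c| ≤ τ} ≤ ENNReal.ofReal (2 * τ / |u|) := by
  rw [unitInterval.volume_apply]
  have hsub : Subtype.val '' {s : unitInterval | |u * (s : ℝ) + c| ≤ τ} ⊆
      Metric.closedBall (-(c / u)) (τ / |u|) := by
    rintro _ ⟨s, hs, rfl⟩
    rw [Metric.mem_closedBall, Real.dist_eq, le_div_iff₀ (abs_pos.mpr hu), ← abs_mul]
    have : ((s : ℝ) - -(c / u)) * u = u * s + c := by field_simp; ring
    rwa [this]
  refine (measure_mono hsub).trans (le_of_eq ?_)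
  rw [Real.volume_closedBall, mul_div_assoc]

/-- A linear form in independent uniform coordinates is rarely small: given all coordinates but
the `j`-th, the `j`-th one has to lie in an interval of length `2 τ / |u j|`. -/
theorem pi_abs_dotProduct_le {n : ℕ} (u : Fin n → ℝ) {j : Fin n} (hj : u j ≠ 0) (τ : ℝ) :
    Measure.pi (fun _ : Fin n => (volume : Measure unitInterval))
      {s | |u ⬝ᵥ (fun i => (s i : ℝ))| ≤ τ} ≤ ENNReal.ofReal (2 * τ / |u j|) := by
  obtain ⟨m, rfl⟩ : ∃ m, n = m + 1 := ⟨n - 1, by have := j.2; omega⟩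
  have hmp := measurePreserving_piFinSuccAbove (fun _ : Fin (m + 1) =>
    (volume : Measure unitInterval)) j
  let S : Set (unitInterval × (Fin m → unitInterval)) :=
    {p | |u j * (p.1 : ℝ) + ∑ i, u (j.succAbove i) * (p.2 i : ℝ)| ≤ τ}
  have hS : MeasurableSet S := by
    refine measurableSet_le ?_ measurable_const
    fun_prop
  have heq : {s : Fin (m + 1) → unitInterval | |u ⬝ᵥ (fun i => (s i : ℝ))| ≤ τ} =
      MeasurableEquiv.piFinSuccAbove (fun _ => unitInterval) j ⁻¹' S := by
    ext s
    simp only [Set.mem_ofPred_eq, dotProduct, Fin.sum_univ_succAbove _ j]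
    rfl
  rw [heq, hmp.measure_preimage hS.nullMeasurableSet, Measure.prod_apply_symm hS]
  refine (lintegral_mono fun y => ?_).trans
    (le_of_eq (by simp : ∫⁻ _y, ENNReal.ofReal (2 * τ / |u j|)
      ∂(Measure.pi fun _ : Fin m => (volume : Measure unitInterval)) = _))
  exact volume_abs_mul_add_le hj (∑ i, u (j.succAbove i) * (y i : ℝ)) τ

end Random

/-! ### Correctness of the bisection for the smallest eigenvalue -/

section Step

variable {n : ℕ}

/-- The vector on which a bisection step performs its test. -/
noncomputable def testVec (C : Matrix (Fin n) (Fin n) ℝ) (ρ δ : ℝ) (v : Fin n → ℝ)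
    (s : EVState n) : Fin n → ℝ :=
  (loop (chebStep C ρ (s.lo + 2 * (s.hi - s.lo) / 3))
    ⌈Real.log (5 * n / δ) / √((s.hi - s.lo) / (6 * ρ))⌉₊ (v, v)).val.2

variable {C : Matrix (Fin n) (Fin n) ℝ} {ρ δ : ℝ} {v : Fin n → ℝ}

theorem evStep_val (C : Matrix (Fin n) (Fin n) ℝ) (ρ δ : ℝ) (v : Fin n → ℝ) (s : EVState n) :
    (evStep C ρ δ v s).val =
      if testVec C ρ δ v s ⬝ᵥ (C *ᵥ testVec C ρ δ v s) <
          (s.lo + 2 * (s.hi - s.lo) / 3) * (testVec C ρ δ v s ⬝ᵥ testVec C ρ δ v s) then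
        ⟨s.lo, s.lo + 2 * (s.hi - s.lo) / 3,
          (1 / √(testVec C ρ δ v s ⬝ᵥ testVec C ρ δ v s)) • testVec C ρ δ v s⟩
      else ⟨s.lo + (s.hi - s.lo) / 3, s.hi, s.vec⟩ := by
  by_cases h : testVec C ρ δ v s ⬝ᵥ (C *ᵥ testVec C ρ δ v s) <
      (s.lo + 2 * (s.hi - s.lo) / 3) * (testVec C ρ δ v s ⬝ᵥ testVec C ρ δ v s)
  · rw [if_pos h]
    exact congrArg Timed.val (if_pos h)
  · rw [if_neg h]
    exact congrArg Timed.val (if_neg h)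

theorem evStep_gap (C : Matrix (Fin n) (Fin n) ℝ) (ρ δ : ℝ) (v : Fin n → ℝ) (s : EVState n) :
    (evStep C ρ δ v s).val.hi - (evStep C ρ δ v s).val.lo = 2 / 3 * (s.hi - s.lo) := by
  rw [evStep_val]
  split_ifs <;> simp only <;> ring

theorem iterate_evStep_gap (C : Matrix (Fin n) (Fin n) ℝ) (ρ δ : ℝ) (v x : Fin n → ℝ) (j : ℕ) :
    ((fun s => (evStep C ρ δ v s).val)^[j] ⟨-ρ, ρ, x⟩).hi -
      ((fun s => (evStep C ρ δ v s).val)^[j] ⟨-ρ, ρ, x⟩).lo = (2 / 3) ^ j * (2 * ρ) := by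
  induction j with
  | zero => simp; ring
  | succ j ih => rw [Function.iterate_succ_apply', evStep_gap, ih, pow_succ]; ring

/-- The loop invariant of the bisection: `lo` bounds the spectrum from below, and `vec` is a unit
vector whose Rayleigh quotient is at most `hi`. -/
structure EVInvariant (C : Matrix (Fin n) (Fin n) ℝ) (ρ : ℝ) (s : EVState n) : Prop where
  neg_le_lo : -ρ ≤ s.lo
  lo_lt_hi : s.lo < s.hi
  hi_le : s.hi ≤ ρ
  lo_le : s.lo ≤ lambdaMin C
  unit : s.vec ⬝ᵥ s.vec = 1
  rayleigh_le : s.vec ⬝ᵥ (C *ᵥ s.vec) ≤ s.hi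

theorem EVInvariant.evStep (hC : C.IsHermitian) (hn : 1 ≤ n) (hρ : 0 < ρ) (hCρ : opNorm C ≤ ρ)
    (hδ : 0 < δ) (hδ' : δ ≤ 1 / 2) {i : Fin n} (hi : hC.eigenvalues i = lambdaMin C)
    (hv : v ⬝ᵥ v ≤ n) (hvi : δ / (2 * √n) ≤ |eigCoord hC i v|) {s : EVState n}
    (hs : EVInvariant C ρ s) : EVInvariant C ρ (evStep C ρ δ v s).val := by
  obtain ⟨h1, h2, h3, h4, h5, h6⟩ := hs
  rw [evStep_val]
  split_ifs with htest
  · have hq : testVec C ρ δ v s ≠ 0 := by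
      intro h
      simp [h] at htest
    have hpos : 0 < testVec C ρ δ v s ⬝ᵥ testVec C ρ δ v s :=
      lt_of_le_of_ne (by simpa using dotProduct_star_self_nonneg (testVec C ρ δ v s))
        (fun h => hq (dotProduct_self_eq_zero.mp h.symm))
    refine ⟨h1, by simp only; linarith, by simp only; linarith, h4,
      normalize_dotProduct_self hq, ?_⟩
    simp only [Matrix.mulVec_smul, smul_dotProduct, dotProduct_smul, smul_eq_mul]
    rw [← mul_assoc, div_mul_div_comm, Real.mul_self_sqrt hpos.le, one_mul, one_div,
      inv_mul_le_iff₀ hpos, mul_comm]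
    exact htest.le
  · refine ⟨by simp only; linarith, by simp only; linarith, h3, ?_, h5, h6⟩
    have h := sub_le_lambdaMin_of_test hC hn hρ hCρ
      (t := s.lo + 2 * (s.hi - s.lo) / 3) (g := s.hi - s.lo) (by linarith) (by linarith)
      (by linarith) hδ hδ' hi hv hvi (Nat.le_ceil _) (not_lt.mp htest)
    simp only
    linarith

theorem EVInvariant.iterate (hC : C.IsHermitian) (hn : 1 ≤ n) (hρ : 0 < ρ) (hCρ : opNorm C ≤ ρ)
    (hδ : 0 < δ) (hδ' : δ ≤ 1 / 2) {i : Fin n} (hi : hC.eigenvalues i = lambdaMin C)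
    (hv : v ⬝ᵥ v ≤ n) (hvi : δ / (2 * √n) ≤ |eigCoord hC i v|) {s : EVState n}
    (hs : EVInvariant C ρ s) (j : ℕ) :
    EVInvariant C ρ ((fun s => (GTRS.evStep C ρ δ v s).val)^[j] s) := by
  induction j with
  | zero => exact hs
  | succ j ih =>
    rw [Function.iterate_succ_apply']
    exact ih.evStep hC hn hρ hCρ hδ hδ' hi hv hvi

/-- The number of bisection steps makes `(3/2) ^ J` comparable to `2 ρ / ε`. -/
theorem two_mul_div_le_pow_ceil {x : ℝ} (hx : 1 ≤ x) :
    x ≤ (3 / 2 : ℝ) ^ ⌈Real.log x / Real.log (3 / 2)⌉₊ ∧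
      (3 / 2 : ℝ) ^ ⌈Real.log x / Real.log (3 / 2)⌉₊ ≤ 3 / 2 * x := by
  have hl : 0 < Real.log (3 / 2) := Real.log_pos (by norm_num)
  have hx0 : 0 < x := by linarith
  have h1 := Nat.le_ceil (Real.log x / Real.log (3 / 2))
  have h2 := (Nat.ceil_lt_add_one (div_nonneg (Real.log_nonneg hx) hl.le)).le
  rw [div_le_iff₀ hl] at h1
  rw [← sub_le_iff_le_add, le_div_iff₀ hl] at h2
  constructor
  · rw [← Real.log_le_log_iff hx0 (by positivity), Real.log_pow]
    exact h1
  · rw [← Real.log_le_log_iff (by positivity) (by positivity), Real.log_pow,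
      Real.log_mul (by norm_num) hx0.ne']
    linarith

theorem approxMinEVRun_val (C : Matrix (Fin n) (Fin n) ℝ) (ρ ε δ : ℝ) (v : Fin n → ℝ) :
    (approxMinEVRun C ρ ε δ v).val =
      let x := ((fun s => (evStep C ρ δ v s).val)^[⌈Real.log (2 * ρ / ε) / Real.log (3 / 2)⌉₊]
        ⟨-ρ, ρ, (1 / √(v ⬝ᵥ v)) • v⟩).vec
      (x ⬝ᵥ (C *ᵥ x), x) := by
  simp only [approxMinEVRun, Timed.val_bind, val_charge, quadForm_val, loop_val, normalize_val,
    Timed.val_pure]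

theorem approxMinEVRun_correct (hC : C.IsHermitian) (hn : 1 ≤ n) (hCρ : opNorm C ≤ ρ) {ε : ℝ}
    (hε : 0 < ε) (hερ : ε ≤ ρ) (hδ : 0 < δ) (hδ' : δ ≤ 1 / 2) {i : Fin n}
    (hi : hC.eigenvalues i = lambdaMin C) (hv : v ⬝ᵥ v ≤ n)
    (hvi : δ / (2 * √n) ≤ |eigCoord hC i v|) :
    (approxMinEVRun C ρ ε δ v).val.2 ⬝ᵥ (approxMinEVRun C ρ ε δ v).val.2 = 1 ∧
      (approxMinEVRun C ρ ε δ v).val.1 = (approxMinEVRun C ρ ε δ v).val.2 ⬝ᵥ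
        (C *ᵥ (approxMinEVRun C ρ ε δ v).val.2) ∧
      (approxMinEVRun C ρ ε δ v).val.2 ⬝ᵥ (C *ᵥ (approxMinEVRun C ρ ε δ v).val.2) ≤
        lambdaMin C + ε := by
  have hρ : 0 < ρ := hε.trans_le hερ
  have hn' : (0 : ℝ) < √n := Real.sqrt_pos.mpr (by exact_mod_cast hn)
  have hv0 : v ≠ 0 := by
    rintro rfl
    have : 0 < δ / (2 * √n) := by positivity
    simp [eigCoord] at hvi
    linarith
  have hx1 := normalize_dotProduct_self hv0
  have hinit : EVInvariant C ρ ⟨-ρ, ρ, (1 / √(v ⬝ᵥ v)) • v⟩ := by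
    refine ⟨le_rfl, by simp only; linarith, le_rfl, ?_, hx1, ?_⟩
    · linarith [(abs_le.mp ((abs_lambdaMin_le hC hn).trans hCρ)).1]
    · have := abs_dotProduct_mulVec_le C ((1 / √(v ⬝ᵥ v)) • v)
      rw [hx1, mul_one] at this
      exact (le_abs_self _).trans (this.trans hCρ)
  have hfin := hinit.iterate hC hn hρ hCρ hδ hδ' hi hv hvi
    ⌈Real.log (2 * ρ / ε) / Real.log (3 / 2)⌉₊
  have hgap := iterate_evStep_gap C ρ δ v ((1 / √(v ⬝ᵥ v)) • v)
    ⌈Real.log (2 * ρ / ε) / Real.log (3 / 2)⌉₊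
  have hpow := (two_mul_div_le_pow_ceil (x := 2 * ρ / ε)
    (by rw [le_div_iff₀ hε]; linarith)).1
  rw [approxMinEVRun_val]
  refine ⟨hfin.unit, rfl, ?_⟩
  have hle : (2 / 3 : ℝ) ^ ⌈Real.log (2 * ρ / ε) / Real.log (3 / 2)⌉₊ * (2 * ρ) ≤ ε := by
    have : (2 / 3 : ℝ) = (3 / 2)⁻¹ := by norm_num
    rw [this, inv_pow, inv_mul_le_iff₀ (by positivity)]
    rwa [div_le_iff₀ hε] at hpow
  have h1 := hfin.rayleigh_le
  have h2 := hfin.lo_le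
  linarith

theorem approxMinEV_prob (hC : C.IsHermitian) (hn : 1 ≤ n) (hCρ : opNorm C ≤ ρ) {ε : ℝ}
    (hε : 0 < ε) (hερ : ε ≤ ρ) (hδ : 0 < δ) (hδ' : δ ≤ 1 / 2) :
    ENNReal.ofReal (1 - δ) ≤ approxMinEV.law n {s |
        let lam := (approxMinEV.run C ρ ε δ s).val.1
        let x := (approxMinEV.run C ρ ε δ s).val.2
        x ⬝ᵥ x = 1 ∧ lam = x ⬝ᵥ (C *ᵥ x) ∧ x ⬝ᵥ (C *ᵥ x) ≤ lambdaMin C + ε} := by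
  obtain ⟨i, hi⟩ := exists_eigenvalues_eq_lambdaMin hC hn
  have hn' : (0 : ℝ) < √n := Real.sqrt_pos.mpr (by exact_mod_cast hn)
  obtain ⟨j, hj⟩ := exists_inv_sqrt_le_abs hn (eigenvectorBasis_dotProduct_self hC i)
  have hj0 : 0 < |(hC.eigenvectorBasis i).ofLp j| := lt_of_lt_of_le (by positivity) hj
  change _ ≤ MeasureTheory.Measure.pi (fun _ : Fin n =>
    (MeasureTheory.volume : MeasureTheory.Measure unitInterval)) _
  set P := MeasureTheory.Measure.pi (fun _ : Fin n =>
    (MeasureTheory.volume : MeasureTheory.Measure unitInterval)) with hP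
  set bad : Set (Fin n → unitInterval) :=
    {s | |(hC.eigenvectorBasis i).ofLp ⬝ᵥ (fun i => (s i : ℝ))| ≤ δ / (2 * √n)} with hbad
  have hbm : MeasurableSet bad := by
    refine measurableSet_le ?_ measurable_const
    simp only [dotProduct]
    fun_prop
  have hbδ : P bad ≤ ENNReal.ofReal δ := by
    refine (pi_abs_dotProduct_le _ (abs_pos.mp hj0) _).trans (ENNReal.ofReal_le_ofReal ?_)
    rw [div_le_iff₀ hj0]
    calc 2 * (δ / (2 * √n)) = δ * (1 / √n) := by field_simp
      _ ≤ _ := mul_le_mul_of_nonneg_left hj hδ.le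
  calc ENNReal.ofReal (1 - δ) = 1 - ENNReal.ofReal δ := by
        rw [ENNReal.ofReal_sub _ hδ.le, ENNReal.ofReal_one]
    _ ≤ 1 - P bad := tsub_le_tsub_left hbδ _
    _ = P badᶜ := (MeasureTheory.prob_compl_eq_one_sub hbm).symm
    _ ≤ _ := by
        refine MeasureTheory.measure_mono fun s hs => ?_
        have hs' : δ / (2 * √n) ≤ |eigCoord hC i (fun i => (s i : ℝ))| := by
          rw [hbad, Set.mem_compl_iff, Set.mem_ofPred_eq, not_le] at hs
          exact hs.le
        refine approxMinEVRun_correct hC hn hCρ hε hερ hδ hδ' hi ?_ hs'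
        calc (fun i => (s i : ℝ)) ⬝ᵥ (fun i => (s i : ℝ)) ≤ ∑ _i : Fin n, (1 : ℝ) :=
              Finset.sum_le_sum fun i _ => mul_le_one₀ (s i).2.2 (s i).2.1 (s i).2.2
          _ = n := by simp

end Step

/-! ### Running time of the concrete oracle -/

section Time

variable {n : ℕ} {C : Matrix (Fin n) (Fin n) ℝ} {ρ δ : ℝ} {v : Fin n → ℝ}

theorem loop_time {α : Type} (f : α → Timed α) (k : ℕ) (a : α) :
    (loop f k a).time =
      ∑ j ∈ Finset.range k, ((f ((fun b => (f b).val)^[j] a)).time + 2) + 1 := by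
  induction k generalizing a with
  | zero => rfl
  | succ k ih => simp [loop, ih, Finset.sum_range_succ']; ring

theorem chebStep_time (C : Matrix (Fin n) (Fin n) ℝ) (ρ t : ℝ) (s : (Fin n → ℝ) × (Fin n → ℝ)) :
    (chebStep C ρ t s).time = 2 * nnz C + 7 * n + 1 := by
  simp [chebStep]; ring

theorem evStep_time_le {N : ℕ} (hn : 1 ≤ n) (hN : n ≤ N) (hC : nnz C ≤ N) (s : EVState n) :
    (evStep C ρ δ v s).time ≤
      28 * N * (⌈Real.log (5 * n / δ) / √((s.hi - s.lo) / (6 * ρ))⌉₊ + 1) := by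
  -- the two branches of the test are bounded for an arbitrary condition
  have hb : ∀ (p : Prop) [Decidable p] (a b : Timed (EVState n)), a.time ≤ 3 * n + 2 →
      b.time ≤ 3 * n + 2 → (if p then a else b).time ≤ 3 * n + 2 := by
    intro p _ a b ha hb
    split_ifs <;> assumption
  simp only [evStep, Timed.time_bind, time_charge, val_charge, quadForm_time, dot_time, time_tick,
    loop_time_of_const (chebStep_time C ρ _)]
  generalize ⌈Real.log (5 * n / δ) / √((s.hi - s.lo) / (6 * ρ))⌉₊ = k
  have h2 : k * (2 * nnz C + 7 * n + 1 + 2) ≤ k * (12 * N) := Nat.mul_le_mul_left _ (by omega)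
  refine le_trans (Nat.add_le_add_left (Nat.add_le_add_left (Nat.add_le_add_left
    (Nat.add_le_add_left (Nat.add_le_add_left (Nat.add_le_add_left
      (Nat.add_le_add_left (hb _ _ _ ?_ ?_) _) _) _) _) _) _) _) ?_
  · simp
  · simp
  · have h3 : 28 * N * (k + 1) = 2 * (k * (12 * N)) + 4 * (k * N) + 28 * N := by ring
    omega

theorem sqrt_pow_eq {x : ℝ} (hx : 0 ≤ x) (j : ℕ) : √(x ^ j) = √x ^ j := by
  rw [← Real.sqrt_sq (pow_nonneg (Real.sqrt_nonneg x) j), ← pow_mul, mul_comm, pow_mul,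
    Real.sq_sqrt hx]

theorem geom_sum_le_five_mul {r : ℝ} (hr : 6 / 5 ≤ r) (J : ℕ) :
    ∑ j ∈ Finset.range J, r ^ j ≤ 5 * r ^ J := by
  induction J with
  | zero => simp
  | succ J ih =>
    rw [Finset.sum_range_succ, pow_succ]
    have : 0 ≤ r ^ J := pow_nonneg (by linarith) J
    nlinarith

theorem log_five_mul_div_le {m δ : ℝ} (hm : 1 ≤ m) (hδ : 0 < δ) (hδ' : δ ≤ 1 / 2) :
    1 ≤ Real.log (5 * m / δ) ∧ Real.log (5 * m / δ) ≤ 4 * Real.log (m / δ) := by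
  have h2 : 2 ≤ m / δ := by rw [le_div_iff₀ hδ]; linarith
  have h0 : 0 < m / δ := by linarith
  have e : 5 * m / δ = 5 * (m / δ) := by ring
  rw [e]
  constructor
  · rw [Real.le_log_iff_exp_le (by positivity)]
    linarith [Real.exp_one_lt_d9]
  · have h8 : 5 * (m / δ) ≤ (m / δ) ^ 4 := by nlinarith [pow_le_pow_left₀ (by norm_num) h2 3]
    calc _ ≤ Real.log ((m / δ) ^ 4) := Real.log_le_log (by positivity) h8
      _ = _ := by rw [Real.log_pow]; norm_num

/-- The gap of the bisection shrinks geometrically, so the number of matrix-vector products grows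
geometrically from one bisection step to the next and the last step dominates. -/
theorem loop_evStep_time_le {N : ℕ} (hn : 1 ≤ n) (hN : n ≤ N) (hC : nnz C ≤ N) {ε : ℝ}
    (hε : 0 < ε) (hερ : ε ≤ ρ) (hδ : 0 < δ) (hδ' : δ ≤ 1 / 2) (x : Fin n → ℝ) :
    ((loop (evStep C ρ δ v) ⌈Real.log (2 * ρ / ε) / Real.log (3 / 2)⌉₊ ⟨-ρ, ρ, x⟩).time : ℝ) ≤
      1350 * N * Real.log (5 * n / δ) * √(ρ / ε) + 1 := by
  have hρ : 0 < ρ := hε.trans_le hερ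
  have hN1 : (1 : ℝ) ≤ N := by exact_mod_cast hn.trans hN
  have hL := (log_five_mul_div_le (m := n) (by exact_mod_cast hn) hδ hδ').1
  set L := Real.log (5 * n / δ) with hLdef
  set J := ⌈Real.log (2 * ρ / ε) / Real.log (3 / 2)⌉₊ with hJ
  have hr : 6 / 5 ≤ √(3 / 2 : ℝ) := Real.le_sqrt_of_sq_le (by norm_num)
  rw [loop_time]
  push_cast
  have hterm : ∀ j ∈ Finset.range J,
      ((evStep C ρ δ v ((fun s => (evStep C ρ δ v s).val)^[j] ⟨-ρ, ρ, x⟩)).time : ℝ) + 2 ≤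
        90 * N * L * √3 * √(3 / 2) ^ j := by
    intro j _
    have h1 := evStep_time_le (ρ := ρ) (δ := δ) (v := v) hn hN hC
      ((fun s => (evStep C ρ δ v s).val)^[j] ⟨-ρ, ρ, x⟩)
    rw [iterate_evStep_gap, ← hLdef] at h1
    -- the `j`-th gap is `2 ρ (2/3) ^ j`
    have h2 : (1 : ℝ) / √((2 / 3) ^ j * (2 * ρ) / (6 * ρ)) = √3 * √(3 / 2) ^ j := by
      have : (2 / 3 : ℝ) ^ j * (2 * ρ) / (6 * ρ) = (3 * (3 / 2) ^ j)⁻¹ := by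
        have : (2 / 3 : ℝ) = (3 / 2)⁻¹ := by norm_num
        rw [this, inv_pow]
        field_simp
        norm_num
      rw [this, Real.sqrt_inv, one_div, inv_inv, Real.sqrt_mul (by norm_num),
        sqrt_pow_eq (by norm_num)]
    have h3 := (Nat.ceil_lt_add_one (a := L / √((2 / 3) ^ j * (2 * ρ) / (6 * ρ)))
      (by positivity)).le
    have h3' : L / √((2 / 3) ^ j * (2 * ρ) / (6 * ρ)) = L * (√3 * √(3 / 2) ^ j) := by
      rw [div_eq_mul_one_div, h2]
    have h4 : 1 ≤ √3 * √(3 / 2 : ℝ) ^ j := by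
      have := one_le_pow₀ (n := j) (show 1 ≤ √(3 / 2 : ℝ) by linarith)
      have h3 : 1 ≤ √(3 : ℝ) := Real.le_sqrt_of_sq_le (by norm_num)
      nlinarith
    have h1' : ((evStep C ρ δ v ((fun s => (evStep C ρ δ v s).val)^[j] ⟨-ρ, ρ, x⟩)).time : ℝ) ≤
        28 * N * ((⌈L / √((2 / 3) ^ j * (2 * ρ) / (6 * ρ))⌉₊ : ℝ) + 1) := by exact_mod_cast h1
    set R := √3 * √(3 / 2 : ℝ) ^ j with hR
    have h5 : 1 ≤ L * R := by nlinarith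
    have h6 : (⌈L / √((2 / 3) ^ j * (2 * ρ) / (6 * ρ))⌉₊ : ℝ) + 1 ≤ 3 * (L * R) := by linarith
    have h7 := mul_le_mul_of_nonneg_left h6 (show (0 : ℝ) ≤ 28 * N by positivity)
    have h8 : (1 : ℝ) ≤ N * (L * R) := by nlinarith
    calc _ ≤ 28 * N * (3 * (L * R)) + 2 := by linarith
      _ ≤ 90 * (N * (L * R)) := by linarith
      _ = _ := by rw [hR]; ring
  have hsum := Finset.sum_le_sum hterm
  rw [← Finset.mul_sum] at hsum
  have hpow := (two_mul_div_le_pow_ceil (x := 2 * ρ / ε)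
    (by rw [le_div_iff₀ hε]; linarith)).2
  rw [← hJ] at hpow
  have hrJ : √(3 / 2 : ℝ) ^ J ≤ √3 * √(ρ / ε) := by
    rw [← sqrt_pow_eq (by norm_num), ← Real.sqrt_mul (by norm_num)]
    refine Real.sqrt_le_sqrt (hpow.trans (le_of_eq ?_))
    ring
  have hgeo : ∑ j ∈ Finset.range J, √(3 / 2 : ℝ) ^ j ≤ 5 * (√3 * √(ρ / ε)) :=
    (geom_sum_le_five_mul hr J).trans (by linarith)
  have hfin := mul_le_mul_of_nonneg_left hgeo (show (0 : ℝ) ≤ 90 * N * L * √3 by positivity)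
  have h33 : √(3 : ℝ) * √3 = 3 := Real.mul_self_sqrt (by norm_num)
  have e : 90 * N * L * √3 * (5 * (√3 * √(ρ / ε))) = 1350 * N * L * √(ρ / ε) := by
    linear_combination 450 * N * L * √(ρ / ε) * h33
  linarith

theorem approxMinEVRun_time_le {N : ℕ} (hn : 1 ≤ n) (hN : n ≤ N) (hC : nnz C ≤ N) {ε : ℝ}
    (hε : 0 < ε) (hερ : ε ≤ ρ) (hδ : 0 < δ) (hδ' : δ ≤ 1 / 2) (v : Fin n → ℝ) :
    ((approxMinEVRun C ρ ε δ v).time : ℝ) ≤ 5472 * (N * √ρ / √ε * Real.log (n / δ)) := by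
  have hρ : 0 < ρ := hε.trans_le hερ
  have hN1 : (1 : ℝ) ≤ N := by exact_mod_cast hn.trans hN
  have hn1 : (n : ℝ) ≤ N := by exact_mod_cast hN
  have hC1 : (nnz C : ℝ) ≤ N := by exact_mod_cast hC
  obtain ⟨hL, hL'⟩ := log_five_mul_div_le (m := n) (by exact_mod_cast hn) hδ hδ'
  have hloop := loop_evStep_time_le (v := v) hn hN hC hε hερ hδ hδ' ((1 / √(v ⬝ᵥ v)) • v)
  have hone : 1 ≤ √(ρ / ε) := by
    rw [Real.one_le_sqrt, le_div_iff₀ hε]; linarith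
  simp only [approxMinEVRun, Timed.time_bind, time_charge, val_charge, quadForm_time,
    normalize_time, normalize_val, Timed.time_pure]
  push_cast
  have h1 : 1 ≤ Real.log (5 * n / δ) * √(ρ / ε) := by nlinarith
  have h2 : (N : ℝ) ≤ N * (Real.log (5 * n / δ) * √(ρ / ε)) := by nlinarith
  have h3 : N * (Real.log (5 * n / δ) * √(ρ / ε)) ≤ N * (4 * Real.log (n / δ) * √(ρ / ε)) := by
    gcongr
  have e : 5472 * (N * √ρ / √ε * Real.log (n / δ)) =
      1368 * (N * (4 * Real.log (n / δ) * √(ρ / ε))) := by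
    rw [Real.sqrt_div hρ.le]; ring
  rw [e]
  linarith

end Time

/-! ### Measurability of the concrete oracle -/

section Measurability

variable {n : ℕ} {Ω : Type} [MeasurableSpace Ω]

theorem measurable_dotProduct {x y : Ω → Fin n → ℝ} (hx : Measurable x) (hy : Measurable y) :
    Measurable fun ω => x ω ⬝ᵥ y ω := by
  simp only [dotProduct]
  exact Finset.measurable_sum _ fun i _ =>
    ((measurable_pi_apply i).comp hx).mul ((measurable_pi_apply i).comp hy)

theorem measurable_mulVec (C : Matrix (Fin n) (Fin n) ℝ) {x : Ω → Fin n → ℝ} (hx : Measurable x) :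
    Measurable fun ω => C *ᵥ x ω :=
  measurable_pi_lambda _ fun _ => measurable_dotProduct measurable_const hx

theorem measurable_normalize {x : Ω → Fin n → ℝ} (hx : Measurable x) :
    Measurable fun ω => (1 / √(x ω ⬝ᵥ x ω)) • x ω := by
  have := measurable_dotProduct hx hx
  exact (measurable_const.div (Real.continuous_sqrt.measurable.comp this)).smul hx

theorem chebStep_val (C : Matrix (Fin n) (Fin n) ℝ) (ρ t : ℝ) (s : (Fin n → ℝ) × (Fin n → ℝ)) :
    (chebStep C ρ t s).val =
      (s.2, (2 / ρ) • (C *ᵥ s.2 - t • s.2) - (2 : ℝ) • s.2 - s.1) := rfl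

theorem measurable_chebStep (C : Matrix (Fin n) (Fin n) ℝ) (ρ : ℝ) {t : Ω → ℝ}
    {s : Ω → (Fin n → ℝ) × (Fin n → ℝ)} (ht : Measurable t) (hs : Measurable s) :
    Measurable fun ω => (chebStep C ρ (t ω) (s ω)).val := by
  simp only [chebStep_val]
  have h1 : Measurable fun ω => C *ᵥ (s ω).2 - t ω • (s ω).2 :=
    (measurable_mulVec C hs.snd).sub (ht.smul hs.snd)
  have h2 : Measurable fun ω => (2 / ρ) • (C *ᵥ (s ω).2 - t ω • (s ω).2) :=
    h1.const_smul (2 / ρ)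
  have h3 : Measurable fun ω => (2 : ℝ) • (s ω).2 := hs.snd.const_smul (2 : ℝ)
  exact hs.snd.prodMk ((h2.sub h3).sub hs.fst)

theorem measurable_natIndex {β : Type} [MeasurableSpace β] {F : ℕ → Ω → β} {k : Ω → ℕ}
    (hF : ∀ m, Measurable (F m)) (hk : Measurable k) : Measurable fun ω => F (k ω) ω :=
  (measurable_from_prod_countable_right (f := fun p : ℕ × Ω => F p.1 p.2) hF).comp
    (hk.prodMk measurable_id)

theorem measurable_loop_chebStep (C : Matrix (Fin n) (Fin n) ℝ) (ρ : ℝ) {t : Ω → ℝ}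
    {k : Ω → ℕ} {v : Ω → Fin n → ℝ} (ht : Measurable t) (hk : Measurable k) (hv : Measurable v) :
    Measurable fun ω => (loop (chebStep C ρ (t ω)) (k ω) (v ω, v ω)).val := by
  simp only [loop_val]
  refine measurable_natIndex
    (F := fun m ω => (fun b => (chebStep C ρ (t ω) b).val)^[m] (v ω, v ω)) (fun m => ?_) hk
  induction m with
  | zero => simpa only [Function.iterate_zero, id] using hv.prodMk hv
  | succ m ih =>
    simp only [Function.iterate_succ_apply']
    exact measurable_chebStep C ρ ht ih

theorem measurable_evStep (C : Matrix (Fin n) (Fin n) ℝ) (ρ δ : ℝ) {v : Ω → Fin n → ℝ}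
    {s : Ω → EVState n} (hv : Measurable v) (hlo : Measurable fun ω => (s ω).lo)
    (hhi : Measurable fun ω => (s ω).hi) (hvec : Measurable fun ω => (s ω).vec) :
    (Measurable fun ω => (evStep C ρ δ (v ω) (s ω)).val.lo) ∧
      (Measurable fun ω => (evStep C ρ δ (v ω) (s ω)).val.hi) ∧
      Measurable fun ω => (evStep C ρ δ (v ω) (s ω)).val.vec := by
  have hg : Measurable fun ω => (s ω).hi - (s ω).lo := hhi.sub hlo
  have ht : Measurable fun ω => (s ω).lo + 2 * ((s ω).hi - (s ω).lo) / 3 :=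
    hlo.add ((hg.const_mul 2).div_const 3)
  have hk : Measurable fun ω =>
      ⌈Real.log (5 * n / δ) / √(((s ω).hi - (s ω).lo) / (6 * ρ))⌉₊ :=
    Nat.measurable_ceil.comp (measurable_const.div
      (Real.continuous_sqrt.measurable.comp (hg.div_const _)))
  have hq : Measurable fun ω => testVec C ρ δ (v ω) (s ω) :=
    (measurable_loop_chebStep C ρ ht hk hv).snd
  have hset : MeasurableSet {ω | testVec C ρ δ (v ω) (s ω) ⬝ᵥ (C *ᵥ testVec C ρ δ (v ω) (s ω)) <
      ((s ω).lo + 2 * ((s ω).hi - (s ω).lo) / 3) *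
        (testVec C ρ δ (v ω) (s ω) ⬝ᵥ testVec C ρ δ (v ω) (s ω))} :=
    measurableSet_lt (measurable_dotProduct hq (measurable_mulVec C hq))
      (ht.mul (measurable_dotProduct hq hq))
  simp only [evStep_val, apply_ite EVState.lo, apply_ite EVState.hi, apply_ite EVState.vec]
  exact ⟨Measurable.ite hset hlo (hlo.add (hg.div_const 3)), Measurable.ite hset ht hhi,
    Measurable.ite hset (measurable_normalize hq) hvec⟩

theorem measurable_approxMinEVRun (C : Matrix (Fin n) (Fin n) ℝ) (ρ ε δ : ℝ) {v : Ω → Fin n → ℝ}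
    (hv : Measurable v) : Measurable fun ω => (approxMinEVRun C ρ ε δ (v ω)).val := by
  have hiter : ∀ m : ℕ, (Measurable fun ω => ((fun s => (evStep C ρ δ (v ω) s).val)^[m]
        ⟨-ρ, ρ, (1 / √(v ω ⬝ᵥ v ω)) • v ω⟩).lo) ∧
      (Measurable fun ω => ((fun s => (evStep C ρ δ (v ω) s).val)^[m]
        ⟨-ρ, ρ, (1 / √(v ω ⬝ᵥ v ω)) • v ω⟩).hi) ∧
      Measurable fun ω => ((fun s => (evStep C ρ δ (v ω) s).val)^[m]
        ⟨-ρ, ρ, (1 / √(v ω ⬝ᵥ v ω)) • v ω⟩).vec := by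
    intro m
    induction m with
    | zero => exact ⟨measurable_const, measurable_const, measurable_normalize hv⟩
    | succ m ih =>
      simp only [Function.iterate_succ_apply']
      exact measurable_evStep C ρ δ hv ih.1 ih.2.1 ih.2.2
  simp only [approxMinEVRun_val]
  have h := (hiter ⌈Real.log (2 * ρ / ε) / Real.log (3 / 2)⌉₊).2.2
  exact (measurable_dotProduct h (measurable_mulVec C h)).prodMk h

end Measurability

theorem isApproxMinEV_approxMinEV : IsApproxMinEV approxMinEV 5472 := by
  intro n N C ρ ε δ hn hN hC hsymm hCρ hε hερ hδ hδ'
  refine ⟨?_, fun s => approxMinEVRun_time_le hn hN hC hε hερ hδ hδ' _,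
    approxMinEV_prob (isHermitian_of_isSymm hsymm) hn hCρ hε hερ hδ hδ'⟩
  have hv : Measurable fun (s : Fin n → unitInterval) (i : Fin n) => (s i : ℝ) :=
    measurable_pi_lambda _ fun i => (measurable_pi_apply i).subtype_val
  exact measurable_approxMinEVRun C ρ ε δ hv


/-! ### Sequences of independent seeds -/

section Seeds

open MeasureTheory

variable {X : Type} [MeasurableSpace X]

/-- The sequence with first term `p.1` and remaining terms `p.2`. -/
def seqCons (p : X × (ℕ → X)) : ℕ → X
  | 0 => p.1
  | i + 1 => p.2 i

theorem measurable_seqCons : Measurable (seqCons (X := X)) := by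
  refine measurable_pi_lambda _ fun i => ?_
  cases i with
  | zero => exact measurable_fst
  | succ i => exact (measurable_pi_apply i).comp measurable_snd

theorem map_seqCons_prod (P : Measure X) [IsProbabilityMeasure P] :
    (P.prod (Measure.infinitePi fun _ : ℕ => P)).map seqCons =
      Measure.infinitePi fun _ : ℕ => P := by
  refine Measure.eq_infinitePi _ fun s t ht => ?_
  rw [Measure.map_apply measurable_seqCons (.pi s.countable_toSet fun i _ => ht i)]
  -- the box, with its sides extended by the whole space to a full initial segment of the indices
  obtain ⟨M, hM⟩ : ∃ M, s ⊆ Finset.range (M + 1) :=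
    ⟨s.sup id, fun i hi => Finset.mem_range.mpr (Nat.lt_succ_of_le (Finset.le_sup (f := id) hi))⟩
  classical
  let t' : ℕ → Set X := fun i => if i ∈ s then t i else Set.univ
  have ht' : ∀ i, MeasurableSet (t' i) := fun i => by
    simp only [t']; split_ifs
    exacts [ht i, MeasurableSet.univ]
  have hpre : seqCons ⁻¹' (s : Set ℕ).pi t =
      t' 0 ×ˢ ((Finset.range M : Set ℕ).pi fun i => t' (i + 1)) := by
    ext ⟨x, ω⟩
    simp only [Set.mem_preimage, Set.mem_pi, Finset.mem_coe, Set.mem_prod, t']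
    constructor
    · intro h
      refine ⟨?_, fun i _ => ?_⟩
      · split_ifs with h0
        exacts [h 0 h0, trivial]
      · split_ifs with h0
        exacts [h _ h0, trivial]
    · rintro ⟨h0, h1⟩ i hi
      cases i with
      | zero => rw [if_pos hi] at h0; exact h0
      | succ i =>
        have := h1 i (by have := Finset.mem_range.mp (hM hi); rw [Finset.mem_range]; omega)
        rwa [if_pos hi] at this
  rw [hpre, Measure.prod_prod, Measure.infinitePi_pi _ fun i _ => ht' _, mul_comm,
    ← Finset.prod_range_succ' (fun i => P (t' i)) M]
  refine (Finset.prod_subset_one_on_sdiff hM (fun i hi => ?_) fun i hi => ?_).symm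
  · simp [t', (Finset.mem_sdiff.mp hi).2]
  · simp [t', hi]

/-- The first seed is independent of the remaining ones, which are distributed like the whole
sequence. -/
theorem infinitePi_head_tail (P : Measure X) [IsProbabilityMeasure P] {S : Set X}
    (hS : MeasurableSet S) {E : Set (ℕ → X)} (hE : MeasurableSet E) :
    Measure.infinitePi (fun _ : ℕ => P) {ω | ω 0 ∈ S ∧ (fun i => ω (i + 1)) ∈ E} =
      P S * Measure.infinitePi (fun _ : ℕ => P) E := by
  have hm : MeasurableSet {ω : ℕ → X | ω 0 ∈ S ∧ (fun i => ω (i + 1)) ∈ E} :=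
    (measurable_pi_apply 0 hS).inter
      ((measurable_pi_lambda _ fun i => measurable_pi_apply (i + 1)) hE)
  conv_lhs => rw [← map_seqCons_prod P]
  rw [Measure.map_apply measurable_seqCons hm, ← Measure.prod_prod]
  rfl

end Seeds

/-! ### The matrix pencil -/

section Pencil

variable {n : ℕ} {A B : Matrix (Fin n) (Fin n) ℝ}

theorem nnz_pencil_le (A B : Matrix (Fin n) (Fin n) ℝ) (μ : ℝ) :
    nnz (μ • A + (1 - μ) • B) ≤ nnz A + nnz B := by
  refine (Set.ncard_le_ncard ?_ (Set.toFinite _)).trans (Set.ncard_union_le _ _)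
  intro p hp
  by_contra h
  simp only [Set.mem_union, Set.mem_ofPred_eq, not_or, not_not] at h
  exact hp (by simp [h.1, h.2])

theorem opNorm_pencil_le (A B : Matrix (Fin n) (Fin n) ℝ) {μ : ℝ} (h0 : 0 ≤ μ) (h1 : μ ≤ 1) :
    opNorm (μ • A + (1 - μ) • B) ≤ opNorm A + opNorm B := by
  rw [opNorm, map_add, map_smul, map_smul]
  refine (norm_add_le _ _).trans ?_
  rw [norm_smul, norm_smul, Real.norm_of_nonneg h0, Real.norm_of_nonneg (by linarith : 0 ≤ 1 - μ)]
  exact add_le_add (mul_le_of_le_one_left (norm_nonneg _) h1)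
    (mul_le_of_le_one_left (norm_nonneg _) (by linarith))

theorem isSymm_pencil (hA : A.IsSymm) (hB : B.IsSymm) (μ : ℝ) :
    (μ • A + (1 - μ) • B).IsSymm := (hA.smul μ).add (hB.smul (1 - μ))

theorem dotProduct_pencil_mulVec (A B : Matrix (Fin n) (Fin n) ℝ) (μ : ℝ) (x : Fin n → ℝ) :
    x ⬝ᵥ ((μ • A + (1 - μ) • B) *ᵥ x) =
      μ * (x ⬝ᵥ (A *ᵥ x)) + (1 - μ) * (x ⬝ᵥ (B *ᵥ x)) := by
  simp [Matrix.add_mulVec, Matrix.smul_mulVec, dotProduct_add]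

/-- A positive definite matrix in the pencil has nonzero diagonal entries. -/
theorem le_nnz_add_nnz {μ ξ : ℝ} (hξ : 0 < ξ)
    (h : (μ • A + (1 - μ) • B - ξ • 1).PosSemidef) : n ≤ nnz A + nnz B := by
  have hdiag : Set.range (fun i : Fin n => (i, i)) ⊆
      {p : Fin n × Fin n | A p.1 p.2 ≠ 0} ∪ {p : Fin n × Fin n | B p.1 p.2 ≠ 0} := by
    rintro _ ⟨i, rfl⟩
    by_contra hi
    simp only [Set.mem_union, Set.mem_ofPred_eq, not_or, not_not] at hi
    have := h.diag_nonneg (i := i)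
    simp [hi.1, hi.2] at this
    linarith
  calc n = (Set.range (fun i : Fin n => (i, i))).ncard := by
        rw [← Set.image_univ, Set.ncard_image_of_injective _ fun i j hij => (Prod.ext_iff.mp hij).1]
        simp
    _ ≤ _ := Set.ncard_le_ncard hdiag (Set.toFinite _)
    _ ≤ _ := Set.ncard_union_le _ _

/-- What the analysis of `PsdPencil` uses of the standing assumption: `φ` bounds the norms, `N`
is the number of stored entries, and the pencil is at least `ξ` at the parameter `ν`. -/
structure PencilBounds (A B : Matrix (Fin n) (Fin n) ℝ) (ξ φ ν : ℝ) (N : ℕ) : Prop where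
  one_le_n : 1 ≤ n
  symmA : A.IsSymm
  symmB : B.IsSymm
  norm_add_le : opNorm A + opNorm B ≤ φ
  xi_pos : 0 < ξ
  xi_le : ξ ≤ φ
  N_eq : N = nnz A + nnz B
  nu_pos : 0 < ν
  nu_le : ν ≤ 1
  posSemidef : (ν • A + (1 - ν) • B - ξ • 1).PosSemidef

theorem StandingAssumption.pencilBounds {ρA ρB ξ φ : ℝ} {N : ℕ}
    (h : StandingAssumption A B ρA ρB ξ) (hφ : ρA + ρB ≤ φ) (hN : N = nnz A + nnz B) :
    ∃ ν, PencilBounds A B ξ φ ν N := by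
  obtain ⟨ν, h0, h1, hp⟩ := h.exists_mu
  have hn : 1 ≤ n := by
    by_contra! hn
    obtain rfl : n = 0 := by omega
    have h2 := h.minB
    have h3 := h.xi_pos
    have : spectrum ℝ B = ∅ := by
      rw [(isHermitian_of_isSymm h.symmB).spectrum_real_eq_range_eigenvalues]
      exact Set.range_eq_empty _
    rw [lambdaMin, this, Real.sInf_empty] at h2
    linarith
  have hA : 0 ≤ opNorm A := norm_nonneg _
  have hB := (abs_le.mp (abs_lambdaMin_le (isHermitian_of_isSymm h.symmB) hn)).1
  have := h.minB
  have h5 := h.normA_le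
  have h6 := h.normB_le
  exact ⟨ν, hn, h.symmA, h.symmB, by linarith, h.xi_pos, by linarith, hN, h0, h1, hp⟩

variable {ξ φ ν : ℝ} {N : ℕ}

theorem PencilBounds.n_le (h : PencilBounds A B ξ φ ν N) : n ≤ N :=
  h.N_eq ▸ le_nnz_add_nnz h.xi_pos h.posSemidef

theorem PencilBounds.phi_pos (h : PencilBounds A B ξ φ ν N) : 0 < φ := h.xi_pos.trans_le h.xi_le

/-- A vector whose quadratic form is too small at `μ` tells on which side of `μ` the parameter
`ν` lies, and that `ν` is not close to `μ`. -/
theorem PencilBounds.lt_of_quadForm_lt (h : PencilBounds A B ξ φ ν N) {μ : ℝ} {x : Fin n → ℝ}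
    (hx : x ⬝ᵥ x = 1) (hlt : x ⬝ᵥ ((μ • A + (1 - μ) • B) *ᵥ x) < 3 * ξ / 4) :
    (x ⬝ᵥ (B *ᵥ x) < x ⬝ᵥ (A *ᵥ x) → ξ / (4 * φ) < ν - μ) ∧
      (¬ x ⬝ᵥ (B *ᵥ x) < x ⬝ᵥ (A *ᵥ x) → ξ / (4 * φ) < μ - ν) := by
  have hφ := h.phi_pos
  have hp := h.posSemidef.dotProduct_mulVec_nonneg x
  rw [star_trivial, Matrix.sub_mulVec, dotProduct_sub, dotProduct_pencil_mulVec,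
    Matrix.smul_mulVec, Matrix.one_mulVec, dotProduct_smul, hx] at hp
  rw [dotProduct_pencil_mulVec] at hlt
  have hA := abs_le.mp (abs_dotProduct_mulVec_le A x)
  have hB := abs_le.mp (abs_dotProduct_mulVec_le B x)
  have hn := h.norm_add_le
  rw [hx, mul_one] at hA hB
  simp only [smul_eq_mul, mul_one] at hp
  generalize x ⬝ᵥ (A *ᵥ x) = a at *
  generalize x ⬝ᵥ (B *ᵥ x) = b at *
  have key : ξ / 4 < (ν - μ) * (a - b) := by linarith
  have hξ := h.xi_pos
  constructor
  · intro hab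
    rw [div_lt_iff₀ (by positivity)]
    have hpos : 0 < ν - μ := by
      by_contra! hc
      nlinarith
    nlinarith
  · intro hab
    rw [div_lt_iff₀ (by positivity)]
    have hpos : 0 < μ - ν := by
      by_contra! hc
      nlinarith
    nlinarith

end Pencil

/-! ### The bisection on the pencil parameter -/

section Bisection

open MeasureTheory

variable {n N : ℕ} {A B : Matrix (Fin n) (Fin n) ℝ} {ξ φ ν K δ' : ℝ} {O : EVProcedure}

/-- The answer demanded of the oracle on the matrix `C` with accuracy `ε`. -/
def OracleGood (C : Matrix (Fin n) (Fin n) ℝ) (ε : ℝ) (r : ℝ × (Fin n → ℝ)) : Prop :=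
  r.2 ⬝ᵥ r.2 = 1 ∧ r.1 = r.2 ⬝ᵥ (C *ᵥ r.2) ∧ r.2 ⬝ᵥ (C *ᵥ r.2) ≤ lambdaMin C + ε

theorem measurableSet_oracleGood (C : Matrix (Fin n) (Fin n) ℝ) (ε : ℝ) {Ω : Type}
    [MeasurableSpace Ω] {r : Ω → ℝ × (Fin n → ℝ)} (hr : Measurable r) :
    MeasurableSet {s | OracleGood C ε (r s)} := by
  have hq := measurable_dotProduct hr.snd (measurable_mulVec C hr.snd)
  exact (measurableSet_eq_fun (measurable_dotProduct hr.snd hr.snd) measurable_const).inter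
    ((measurableSet_eq_fun hr.fst hq).inter (measurableSet_le hq measurable_const))

/-- The oracle guarantee for the calls that `PsdPencil` makes. -/
theorem PencilBounds.oracle (h : PencilBounds A B ξ φ ν N) (hO : IsApproxMinEV O K)
    (hδ : 0 < δ') (hδ' : δ' ≤ 1 / 2) {μ : ℝ} (h0 : 0 ≤ μ) (h1 : μ ≤ 1) :
    Measurable (fun s => (O.run (μ • A + (1 - μ) • B) φ (ξ / 4) δ' s).val) ∧
      (∀ s, ((O.run (μ • A + (1 - μ) • B) φ (ξ / 4) δ' s).time : ℝ) ≤
        K * (N * √φ / √(ξ / 4) * Real.log (n / δ'))) ∧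
      O.law n {s | ¬ OracleGood (μ • A + (1 - μ) • B) (ξ / 4)
        (O.run (μ • A + (1 - μ) • B) φ (ξ / 4) δ' s).val} ≤ ENNReal.ofReal δ' := by
  have hξ := h.xi_pos
  have hξφ := h.xi_le
  obtain ⟨hm, ht, hp⟩ := hO n N (μ • A + (1 - μ) • B) φ (ξ / 4) δ' h.one_le_n h.n_le
    (h.N_eq ▸ nnz_pencil_le A B μ) (isSymm_pencil h.symmA h.symmB μ)
    ((opNorm_pencil_le A B h0 h1).trans h.norm_add_le) (by linarith) (by linarith) hδ hδ'
  refine ⟨hm, ht, ?_⟩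
  have hc := prob_compl_eq_one_sub (μ := O.law n)
    (measurableSet_oracleGood (μ • A + (1 - μ) • B) (ξ / 4) hm)
  refine (le_of_eq hc).trans ?_
  calc _ ≤ 1 - ENNReal.ofReal (1 - δ') := tsub_le_tsub_left hp _
    _ = ENNReal.ofReal δ' := by
        rw [← ENNReal.ofReal_one, ← ENNReal.ofReal_sub _ (by linarith)]
        congr 1
        ring

/-- The outcome that `PsdPencil` should have. -/
def PencilSuccess (A B : Matrix (Fin n) (Fin n) ℝ) (ξ : ℝ)
    (out : Option (ℝ × ℝ × (Fin n → ℝ))) : Prop :=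
  ∃ (μ lam : ℝ) (x : Fin n → ℝ), out = some (μ, lam, x) ∧ 0 < μ ∧ μ ≤ 1 ∧ x ⬝ᵥ x = 1 ∧
    lam = x ⬝ᵥ ((μ • A + (1 - μ) • B) *ᵥ x) ∧ 3 * ξ / 4 ≤ lam ∧
    lam - ξ / 4 ≤ lambdaMin (μ • A + (1 - μ) • B)

/-- The answer of the oracle in the pass with midpoint `μ`. -/
noncomputable def pencilCall (O : EVProcedure) {n : ℕ} (A B : Matrix (Fin n) (Fin n) ℝ)
    (ξ φ δ' μ : ℝ) (s : O.Seed n) : ℝ × (Fin n → ℝ) :=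
  (O.run (μ • A + (1 - μ) • B) φ (ξ / 4) δ' s).val

theorem psdPencilLoop_val_of_le {δ T : ℝ} {k : ℕ} {μ₁ μ₂ : ℝ} {ω : ℕ → O.Seed n}
    (h : 3 * ξ / 4 ≤ (pencilCall O A B ξ φ (δ / T) ((μ₁ + μ₂) / 2) (ω 0)).1) :
    (psdPencilLoop O A B ξ φ δ T (k + 1) μ₁ μ₂ ω).val =
      ⟨some ((μ₁ + μ₂) / 2, pencilCall O A B ξ φ (δ / T) ((μ₁ + μ₂) / 2) (ω 0)), 1⟩ :=
  congrArg Timed.val (if_pos h)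

theorem psdPencilLoop_val_of_lt {δ T : ℝ} {k : ℕ} {μ₁ μ₂ : ℝ} {ω : ℕ → O.Seed n}
    (h : ¬ 3 * ξ / 4 ≤ (pencilCall O A B ξ φ (δ / T) ((μ₁ + μ₂) / 2) (ω 0)).1) :
    (psdPencilLoop O A B ξ φ δ T (k + 1) μ₁ μ₂ ω).val =
      let x := (pencilCall O A B ξ φ (δ / T) ((μ₁ + μ₂) / 2) (ω 0)).2
      let rest := (psdPencilLoop O A B ξ φ δ T k
        (if x ⬝ᵥ (B *ᵥ x) < x ⬝ᵥ (A *ᵥ x) then (μ₁ + μ₂) / 2 else μ₁)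
        (if x ⬝ᵥ (B *ᵥ x) < x ⬝ᵥ (A *ᵥ x) then μ₂ else (μ₁ + μ₂) / 2)
        (fun i => ω (i + 1))).val
      ⟨rest.out, rest.calls + 1⟩ :=
  congrArg Timed.val (if_neg h)

theorem psdPencilLoop_calls_le (δ T : ℝ) (k : ℕ) (μ₁ μ₂ : ℝ) (ω : ℕ → O.Seed n) :
    (psdPencilLoop O A B ξ φ δ T k μ₁ μ₂ ω).val.calls ≤ k := by
  induction k generalizing μ₁ μ₂ ω with
  | zero => exact le_rfl
  | succ k ih =>
    by_cases h : 3 * ξ / 4 ≤ (pencilCall O A B ξ φ (δ / T) ((μ₁ + μ₂) / 2) (ω 0)).1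
    · rw [psdPencilLoop_val_of_le h]
      simp
    · rw [psdPencilLoop_val_of_lt h]
      exact Nat.add_le_add_right (ih _ _ _) 1

/-- The cost of one pass, given a bound `R` on the rest of the run in both halves of the
interval. -/
theorem psdPencilLoop_time_succ_le (δ T : ℝ) (k : ℕ) (μ₁ μ₂ : ℝ) (ω : ℕ → O.Seed n) {R : ℕ}
    (hR : ∀ a b, (a = μ₁ ∧ b = (μ₁ + μ₂) / 2) ∨ (a = (μ₁ + μ₂) / 2 ∧ b = μ₂) →
      (psdPencilLoop O A B ξ φ δ T k a b (fun i => ω (i + 1))).time ≤ R) :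
    (psdPencilLoop O A B ξ φ δ T (k + 1) μ₁ μ₂ ω).time ≤
      (O.run (((μ₁ + μ₂) / 2) • A + (1 - (μ₁ + μ₂) / 2) • B) φ (ξ / 4) (δ / T) (ω 0)).time +
        (4 * (nnz A + nnz B) + 6 * n + 11) + R := by
  have hb : ∀ (p : Prop) [Decidable p] (a b : Timed (PencilResult n)) (c : ℕ), a.time ≤ c →
      b.time ≤ c → (if p then a else b).time ≤ c := by
    intro p _ a b c ha hb
    split_ifs <;> assumption
  have hends : ∀ (p : Prop) [Decidable p],
      ((if p then (μ₁ + μ₂) / 2 else μ₁) = μ₁ ∧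
        (if p then μ₂ else (μ₁ + μ₂) / 2) = (μ₁ + μ₂) / 2) ∨
      ((if p then (μ₁ + μ₂) / 2 else μ₁) = (μ₁ + μ₂) / 2 ∧
        (if p then μ₂ else (μ₁ + μ₂) / 2) = μ₂) := by
    intro p _
    split_ifs
    exacts [Or.inr ⟨rfl, rfl⟩, Or.inl ⟨rfl, rfl⟩]
  simp only [psdPencilLoop, Timed.time_bind, time_charge, val_charge, time_tick, pencil]
  refine le_trans (Nat.add_le_add_left (Nat.add_le_add_left (Nat.add_le_add_left
    (Nat.add_le_add_left (Nat.add_le_add_left (Nat.add_le_add_left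
      (hb _ _ _ (2 * nnz A + 3 * n + (2 * nnz B + 3 * n + (1 + R))) ?_ ?_) _) _) _) _) _) _) ?_
  · simp
  · simp only [Timed.time_bind, quadForm_time, quadForm_val, time_tick, Timed.time_pure, add_zero]
    refine Nat.add_le_add_left (Nat.add_le_add_left (Nat.add_le_add_left ?_ _) _) _
    exact hR _ _ (hends _)
  · omega

/-- Every pass costs one oracle call and `O(N)` steps of its own. -/
theorem PencilBounds.psdPencilLoop_time_le (h : PencilBounds A B ξ φ ν N)
    (hO : IsApproxMinEV O K) {δ T : ℝ} (hδ : 0 < δ / T) (hδ' : δ / T ≤ 1 / 2) {R : ℝ}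
    (hR : K * (N * √φ / √(ξ / 4) * Real.log (n / (δ / T))) ≤ R) (k : ℕ) {μ₁ μ₂ : ℝ}
    (h0 : 0 ≤ μ₁) (h1 : μ₁ ≤ μ₂) (h2 : μ₂ ≤ 1) (ω : ℕ → O.Seed n) :
    ((psdPencilLoop O A B ξ φ δ T k μ₁ μ₂ ω).time : ℝ) ≤ k * (R + 21 * N) + 1 := by
  induction k generalizing μ₁ μ₂ ω with
  | zero => simp [psdPencilLoop]
  | succ k ih =>
    have hcall := (h.oracle hO hδ hδ' (μ := (μ₁ + μ₂) / 2) (by linarith) (by linarith)).2.1 (ω 0)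
    set t := max (psdPencilLoop O A B ξ φ δ T k μ₁ ((μ₁ + μ₂) / 2) (fun i => ω (i + 1))).time
      (psdPencilLoop O A B ξ φ δ T k ((μ₁ + μ₂) / 2) μ₂ (fun i => ω (i + 1))).time with ht
    have hstep := psdPencilLoop_time_succ_le (A := A) (B := B) (ξ := ξ) (φ := φ) δ T k μ₁ μ₂ ω
      (R := t) (by
        rintro a b (⟨rfl, rfl⟩ | ⟨rfl, rfl⟩)
        exacts [le_max_left _ _, le_max_right _ _])
    have hrest : (t : ℝ) ≤ k * (R + 21 * N) + 1 := by
      rw [ht, Nat.cast_max]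
      exact max_le (ih h0 (by linarith) (by linarith) _) (ih (by linarith) (by linarith) h2 _)
    have hover : 4 * (nnz A + nnz B) + 6 * n + 11 ≤ 21 * N := by
      have := h.N_eq; have := h.n_le; have := h.one_le_n
      omega
    have hstep' := (Nat.cast_le (α := ℝ)).mpr (hstep.trans
      (Nat.add_le_add_right (Nat.add_le_add_left hover _) _))
    push_cast at hstep' ⊢
    linarith

/-- Every pass fails with probability at most `δ / T`. When no pass fails, the parameter `ν` stays
in the interval, which keeps the interval longer than `ξ / (4 φ)`, so that the loop must return
before its length is halved below this threshold. The measurable hulls of the two events that the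
remaining passes fail spare the measurability of the whole run. -/
theorem PencilBounds.fail_measure_le (h : PencilBounds A B ξ φ ν N) (hO : IsApproxMinEV O K)
    {δ T : ℝ} (hδ : 0 < δ / T) (hδ' : δ / T ≤ 1 / 2) (k : ℕ) {μ₁ μ₂ : ℝ}
    (h0 : 0 ≤ μ₁) (h1 : μ₁ ≤ ν) (h2 : ν ≤ μ₂) (h3 : μ₂ ≤ 1) (hlen : ξ / (4 * φ) < μ₂ - μ₁)
    (hk : (μ₂ - μ₁) / 2 ^ k ≤ ξ / (4 * φ)) :
    Measure.infinitePi (fun _ : ℕ => O.law n)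
      {ω | ¬ PencilSuccess A B ξ (psdPencilLoop O A B ξ φ δ T k μ₁ μ₂ ω).val.out} ≤
        k * ENNReal.ofReal (δ / T) := by
  induction k generalizing μ₁ μ₂ with
  | zero => rw [pow_zero, div_one] at hk; exact absurd hlen (not_lt.mpr hk)
  | succ k ih =>
    set μ := (μ₁ + μ₂) / 2 with hμ
    set P := Measure.infinitePi (fun _ : ℕ => O.law n) with hP
    have hpos : 0 < ξ / (4 * φ) := div_pos h.xi_pos (by linarith [h.phi_pos])
    have hμ0 : 0 < μ := by rw [hμ]; linarith
    have hμ1 : μ ≤ 1 := by rw [hμ]; linarith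
    obtain ⟨hm, -, hbad⟩ := h.oracle hO hδ hδ' hμ0.le hμ1
    set r : O.Seed n → ℝ × (Fin n → ℝ) := pencilCall O A B ξ φ (δ / T) μ with hr
    set G : Set (O.Seed n) := {s | OracleGood (μ • A + (1 - μ) • B) (ξ / 4) (r s)} with hG
    set S : Set (O.Seed n) := {s | (r s).2 ⬝ᵥ (B *ᵥ (r s).2) < (r s).2 ⬝ᵥ (A *ᵥ (r s).2)} with hS
    have hrm : Measurable r := hm
    have hSm : MeasurableSet S := measurableSet_lt
      (measurable_dotProduct hrm.snd (measurable_mulVec B hrm.snd))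
      (measurable_dotProduct hrm.snd (measurable_mulVec A hrm.snd))
    have hhalf : ∀ a b : ℝ, b - a = (μ₂ - μ₁) / 2 → (b - a) / 2 ^ k ≤ ξ / (4 * φ) := by
      intro a b hab
      rw [hab, div_div, ← pow_succ']
      exact hk
    -- the events that the remaining passes fail on the two halves; an event is made empty when
    -- the interval left is too short to occur after a correct answer of the oracle
    set F₁ : Set (ℕ → O.Seed n) := {ω | ξ / (4 * φ) < ν - μ ∧
      ¬ PencilSuccess A B ξ (psdPencilLoop O A B ξ φ δ T k μ μ₂ ω).val.out} with hF₁
    set F₂ : Set (ℕ → O.Seed n) := {ω | ξ / (4 * φ) < μ - ν ∧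
      ¬ PencilSuccess A B ξ (psdPencilLoop O A B ξ φ δ T k μ₁ μ ω).val.out} with hF₂
    have hF₁le : P F₁ ≤ k * ENNReal.ofReal (δ / T) := by
      by_cases hν : ξ / (4 * φ) < ν - μ
      · exact (measure_mono fun ω hω => hω.2).trans
          (ih hμ0.le (by linarith) h2 h3 (by linarith) (hhalf _ _ (by rw [hμ]; ring)))
      · simp [hF₁, hν]
    have hF₂le : P F₂ ≤ k * ENNReal.ofReal (δ / T) := by
      by_cases hν : ξ / (4 * φ) < μ - ν
      · exact (measure_mono fun ω hω => hω.2).trans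
          (ih h0 h1 (by linarith) hμ1 (by linarith) (hhalf _ _ (by rw [hμ]; ring)))
      · simp [hF₂, hν]
    have hsub : {ω | ¬ PencilSuccess A B ξ
          (psdPencilLoop O A B ξ φ δ T (k + 1) μ₁ μ₂ ω).val.out} ⊆
        (fun ω : ℕ → O.Seed n => ω 0) ⁻¹' Gᶜ ∪
          ({ω | ω 0 ∈ S ∧ (fun i => ω (i + 1)) ∈ toMeasurable P F₁} ∪
            {ω | ω 0 ∈ Sᶜ ∧ (fun i => ω (i + 1)) ∈ toMeasurable P F₂}) := by
      intro ω hω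
      by_cases hg : ω 0 ∈ G
      · right
        obtain ⟨hx, hlam, hle⟩ : OracleGood (μ • A + (1 - μ) • B) (ξ / 4) (r (ω 0)) := hg
        have hlt : ¬ 3 * ξ / 4 ≤ (r (ω 0)).1 := by
          intro hge
          refine hω ?_
          rw [psdPencilLoop_val_of_le hge]
          exact ⟨μ, (r (ω 0)).1, (r (ω 0)).2, rfl, hμ0, hμ1, hx, hlam, hge, by linarith⟩
        obtain ⟨hl, hr'⟩ := h.lt_of_quadForm_lt hx (by rw [← hlam]; exact not_le.mp hlt)
        have hfail : ¬ PencilSuccess A B ξ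
            (psdPencilLoop O A B ξ φ δ T (k + 1) μ₁ μ₂ ω).val.out := hω
        rw [psdPencilLoop_val_of_lt hlt] at hfail
        by_cases hs : (r (ω 0)).2 ⬝ᵥ (B *ᵥ (r (ω 0)).2) < (r (ω 0)).2 ⬝ᵥ (A *ᵥ (r (ω 0)).2)
        · simp only [← hμ, ← hr, if_pos hs] at hfail
          exact Or.inl ⟨hs, subset_toMeasurable P F₁ ⟨hl hs, hfail⟩⟩
        · simp only [← hμ, ← hr, if_neg hs] at hfail
          exact Or.inr ⟨hs, subset_toMeasurable P F₂ ⟨hr' hs, hfail⟩⟩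
      · exact Or.inl hg
    have hGm : MeasurableSet G := measurableSet_oracleGood _ _ hrm
    have hPG : P ((fun ω : ℕ → O.Seed n => ω 0) ⁻¹' Gᶜ) ≤ ENNReal.ofReal (δ / T) := by
      rw [(measurePreserving_eval_infinitePi (fun _ : ℕ => O.law n) 0).measure_preimage
        hGm.compl.nullMeasurableSet]
      exact hbad
    have hsum : O.law n S + O.law n Sᶜ = 1 := by
      rw [measure_add_measure_compl hSm, measure_univ]
    calc _ ≤ P ((fun ω : ℕ → O.Seed n => ω 0) ⁻¹' Gᶜ) +
          (P {ω | ω 0 ∈ S ∧ (fun i => ω (i + 1)) ∈ toMeasurable P F₁} +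
            P {ω | ω 0 ∈ Sᶜ ∧ (fun i => ω (i + 1)) ∈ toMeasurable P F₂}) :=
          (measure_mono hsub).trans ((measure_union_le _ _).trans
            (add_le_add_right (measure_union_le _ _) _))
      _ = P ((fun ω : ℕ → O.Seed n => ω 0) ⁻¹' Gᶜ) +
          (O.law n S * P F₁ + O.law n Sᶜ * P F₂) := by
          rw [infinitePi_head_tail _ hSm (measurableSet_toMeasurable _ _),
            infinitePi_head_tail _ hSm.compl (measurableSet_toMeasurable _ _),
            ← hP, measure_toMeasurable, measure_toMeasurable]
      _ ≤ ENNReal.ofReal (δ / T) + (O.law n S * (k * ENNReal.ofReal (δ / T)) +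
            O.law n Sᶜ * (k * ENNReal.ofReal (δ / T))) := by gcongr
      _ = _ := by
          rw [← add_mul, hsum, one_mul]
          push_cast
          ring

end Bisection

/-! ### Logarithmic bounds on the total running time -/

section Bounds

theorem two_lt_log_eight : 2 < Real.log 8 := by
  have : Real.log 8 = 3 * Real.log 2 := by
    rw [show (8 : ℝ) = 2 ^ 3 by norm_num, Real.log_pow]; norm_num
  rw [this]
  linarith [Real.log_two_gt_d9]

/-- The iteration bound `T = l / log 2`, with `l = log (8 φ / ξ)`, changes neither the number of
passes nor the logarithm of the failure probability by more than a constant factor. -/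
theorem total_time_le {K S m l : ℝ} {N : ℝ} (hS : N ≤ S) (hN : 1 ≤ N) (hm : 1 ≤ m) (hl : 2 ≤ l) :
    l / Real.log 2 * (|K| * (2 * S * Real.log (m * (l / Real.log 2))) + 23 * N) ≤
      (8 * |K| + 92) * (S * Real.log (m * l) * l) := by
  have hlog := Real.log_two_gt_d9
  have hS1 : 1 ≤ S := hN.trans hS
  have hX : 2 ≤ m * l := by nlinarith
  have h2l : l / Real.log 2 ≤ 2 * l := by
    rw [div_le_iff₀ (by linarith)]; nlinarith
  have hlX : Real.log 2 ≤ Real.log (m * l) := Real.log_le_log (by norm_num) hX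
  have h1 : Real.log (m * (l / Real.log 2)) ≤ 2 * Real.log (m * l) := by
    have : m * (l / Real.log 2) ≤ (m * l) ^ 2 := by
      calc _ ≤ m * (2 * l) := by gcongr
        _ = 2 * (m * l) := by ring
        _ ≤ (m * l) ^ 2 := by nlinarith
    have h0 : 0 < m * (l / Real.log 2) := by
      have : 0 < Real.log 2 := by linarith
      positivity
    calc _ ≤ Real.log ((m * l) ^ 2) := Real.log_le_log h0 this
      _ = _ := by rw [Real.log_pow]; norm_num
  have hK := abs_nonneg K
  have h3 : |K| * (2 * S * Real.log (m * (l / Real.log 2))) + 23 * N ≤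
      (4 * |K| + 46) * (S * Real.log (m * l)) := by
    have e1 : |K| * (2 * S * Real.log (m * (l / Real.log 2))) ≤
        |K| * (2 * S * (2 * Real.log (m * l))) := by gcongr
    have e2 : S ≤ 2 * (S * Real.log (m * l)) := by nlinarith
    linarith
  have h4 : 0 ≤ (4 * |K| + 46) * (S * Real.log (m * l)) := by
    have : 0 ≤ Real.log (m * l) := by linarith
    positivity
  calc _ ≤ l / Real.log 2 * ((4 * |K| + 46) * (S * Real.log (m * l))) := by
        refine mul_le_mul_of_nonneg_left h3 ?_
        exact div_nonneg (by linarith) (by linarith)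
    _ ≤ 2 * l * ((4 * |K| + 46) * (S * Real.log (m * l))) :=
        mul_le_mul_of_nonneg_right h2l h4
    _ = _ := by ring

/-- For `ξ ≤ 1 / 4` the quantity `log (8 φ / ξ)` is bounded by `log (1 / ξ)` up to a factor
logarithmic in `φ`. -/
theorem log_mul_log_le {m φ ξ : ℝ} (hm : 1 ≤ m) (hφ : 1 ≤ φ) (hξ : 0 < ξ) (hξ' : ξ ≤ 1 / 4) :
    Real.log (m * Real.log (8 * φ / ξ)) * Real.log (8 * φ / ξ) ≤
      18 * (1 + Real.log φ) ^ 2 * (Real.log (m * Real.log (1 / ξ)) * Real.log (1 / ξ)) := by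
  have hf : 0 ≤ Real.log φ := Real.log_nonneg hφ
  have hlog2 := Real.log_two_gt_d9
  have h4 : Real.log 4 = 2 * Real.log 2 := by
    rw [show (4 : ℝ) = 2 ^ 2 by norm_num, Real.log_pow]; norm_num
  have h8 : Real.log 8 = 3 * Real.log 2 := by
    rw [show (8 : ℝ) = 2 ^ 3 by norm_num, Real.log_pow]; norm_num
  have hq4 : Real.log 4 ≤ Real.log (1 / ξ) :=
    Real.log_le_log (by norm_num) (by rw [le_div_iff₀ hξ]; linarith)
  have hl : Real.log (8 * φ / ξ) = Real.log 8 + Real.log φ + Real.log (1 / ξ) := by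
    rw [show 8 * φ / ξ = 8 * φ * (1 / ξ) by ring, Real.log_mul (by positivity) (by positivity),
      Real.log_mul (by norm_num) (by positivity)]
  rw [hl]
  set f := Real.log φ
  set q := Real.log (1 / ξ)
  have hq : 1.38 ≤ q := by linarith
  have hlq : Real.log 8 + f + q ≤ 5 / 2 * (1 + f) * q := by nlinarith
  have hY : 1.38 ≤ m * q := by nlinarith
  have hlogY : 1 / 4 ≤ Real.log (m * q) := by
    have h1 := Real.one_sub_inv_le_log_of_pos (show (0 : ℝ) < 1.38 by norm_num)
    have h2 := Real.log_le_log (by norm_num) hY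
    norm_num at h1 h2 ⊢
    linarith
  have hlpos : 0 < Real.log 8 + f + q := by linarith
  have hlogX : Real.log (m * (Real.log 8 + f + q)) ≤ 7 * (1 + f) * Real.log (m * q) := by
    have h1 : m * (Real.log 8 + f + q) ≤ 5 / 2 * (1 + f) * (m * q) := by
      calc _ ≤ m * (5 / 2 * (1 + f) * q) := by gcongr
        _ = _ := by ring
    have h2 := Real.log_le_log (by positivity) h1
    have h2' : Real.log (5 / 2 * (1 + f) * (m * q)) =
        Real.log (5 / 2) + Real.log (1 + f) + Real.log (m * q) := by
      rw [Real.log_mul (by positivity) (by positivity), Real.log_mul (by norm_num) (by positivity)]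
    have h3 := Real.log_le_sub_one_of_pos (show (0 : ℝ) < 5 / 2 by norm_num)
    have h5 := Real.log_le_sub_one_of_pos (show (0 : ℝ) < 1 + f by linarith)
    nlinarith
  calc _ ≤ 7 * (1 + f) * Real.log (m * q) * (5 / 2 * (1 + f) * q) := by
        refine mul_le_mul hlogX hlq hlpos.le ?_
        have : 0 ≤ Real.log (m * q) := by linarith
        positivity
    _ = 35 / 2 * (1 + f) ^ 2 * (Real.log (m * q) * q) := by ring
    _ ≤ _ := by
        have : 0 ≤ Real.log (m * q) * q := mul_nonneg (by linarith) (by linarith)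
        gcongr
        norm_num

end Bounds

/-! ### The guarantees of `PsdPencil` -/

section Guarantees

variable {n N : ℕ} {A B : Matrix (Fin n) (Fin n) ℝ} {ξ φ ν K δ : ℝ} {O : EVProcedure}

theorem PencilBounds.two_le_log (h : PencilBounds A B ξ φ ν N) :
    2 ≤ Real.log (8 * φ / ξ) ∧ 3 ≤ Real.logb 2 (8 * φ / ξ) := by
  have hξ := h.xi_pos
  have h8 : 8 ≤ 8 * φ / ξ := by
    rw [le_div_iff₀ hξ]; linarith [h.xi_le]
  constructor
  · linarith [two_lt_log_eight, Real.log_le_log (by norm_num) h8]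
  · rw [Real.le_logb_iff_rpow_le (by norm_num) (by linarith)]
    norm_num
    exact h8

theorem PencilBounds.psdPencil_calls_le (h : PencilBounds A B ξ φ ν N) (ω : ℕ → O.Seed n) :
    ((psdPencil O A B ξ φ δ ω).val.calls : ℝ) ≤ Real.logb 2 (8 * φ / ξ) :=
  (Nat.cast_le.mpr (psdPencilLoop_calls_le δ _ _ 0 1 ω)).trans
    (Nat.floor_le (show 0 ≤ Real.logb 2 (8 * φ / ξ) by linarith [h.two_le_log.2]))

theorem PencilBounds.psdPencil_prob (h : PencilBounds A B ξ φ ν N) (hO : IsApproxMinEV O K)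
    (hδ : 0 < δ) (hδ' : δ < 1) :
    ENNReal.ofReal (1 - δ) ≤ MeasureTheory.Measure.infinitePi (fun _ : ℕ => O.law n)
      {ω : ℕ → O.Seed n | PencilSuccess A B ξ (psdPencil O A B ξ φ δ ω).val.out} := by
  have hξ := h.xi_pos
  have hφ := h.phi_pos
  have hT := h.two_le_log.2
  set T := Real.logb 2 (8 * φ / ξ) with hTdef
  have hδT : 0 < δ / T := div_pos hδ (by linarith)
  have hδT' : δ / T ≤ 1 / 2 := by
    rw [div_le_iff₀ (by linarith)]; linarith
  have hfloor := Nat.floor_le (show 0 ≤ T by linarith)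
  -- after `⌊T⌋` halvings the interval is shorter than `2 / 2 ^ T = ξ / (4 φ)`
  have hpow : 4 * φ / ξ ≤ 2 ^ ⌊T⌋₊ := by
    have h1 : (2 : ℝ) ^ T = 8 * φ / ξ :=
      Real.rpow_logb (by norm_num) (by norm_num) (by positivity)
    have h2 : (2 : ℝ) ^ T ≤ 2 ^ ((⌊T⌋₊ : ℝ) + 1) :=
      Real.rpow_le_rpow_of_exponent_le (by norm_num) (Nat.lt_floor_add_one T).le
    rw [h1, Real.rpow_add_one (by norm_num), Real.rpow_natCast] at h2
    have h3 : 8 * φ / ξ = 4 * φ / ξ * 2 := by ring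
    linarith
  have hfail := h.fail_measure_le hO hδT hδT' ⌊T⌋₊ le_rfl h.nu_pos.le h.nu_le le_rfl
    (by rw [sub_zero, div_lt_one (by positivity)]; linarith [h.xi_le])
    (by
      rw [sub_zero, one_div, ← inv_div]
      exact inv_anti₀ (by positivity) hpow)
  have hfail' : MeasureTheory.Measure.infinitePi (fun _ : ℕ => O.law n)
      {ω : ℕ → O.Seed n | PencilSuccess A B ξ (psdPencil O A B ξ φ δ ω).val.out}ᶜ ≤
        ENNReal.ofReal δ := by
    refine hfail.trans ?_
    rw [← ENNReal.ofReal_natCast, ← ENNReal.ofReal_mul (Nat.cast_nonneg _)]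
    refine ENNReal.ofReal_le_ofReal ?_
    calc (⌊T⌋₊ : ℝ) * (δ / T) ≤ T * (δ / T) := by gcongr
      _ = δ := by field_simp
  rw [ENNReal.ofReal_sub _ hδ.le, ENNReal.ofReal_one, tsub_le_iff_right]
  calc (1 : ENNReal) = MeasureTheory.Measure.infinitePi (fun _ : ℕ => O.law n)
        ({ω : ℕ → O.Seed n | PencilSuccess A B ξ (psdPencil O A B ξ φ δ ω).val.out} ∪
          {ω : ℕ → O.Seed n | PencilSuccess A B ξ (psdPencil O A B ξ φ δ ω).val.out}ᶜ) := by
        rw [Set.union_compl_self, MeasureTheory.measure_univ]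
    _ ≤ _ := (MeasureTheory.measure_union_le _ _).trans (add_le_add_right hfail' _)

theorem PencilBounds.psdPencil_time_le (h : PencilBounds A B ξ φ ν N) (hO : IsApproxMinEV O K)
    (hδ : 0 < δ) (hδ' : δ < 1) (ω : ℕ → O.Seed n) :
    ((psdPencil O A B ξ φ δ ω).time : ℝ) ≤ (8 * |K| + 92) *
      (N * √φ / √ξ * Real.log (n / δ * Real.log (8 * φ / ξ)) * Real.log (8 * φ / ξ)) := by
  have hξ := h.xi_pos
  have hφ := h.phi_pos
  obtain ⟨hl, hT⟩ := h.two_le_log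
  have hn : (1 : ℝ) ≤ n := by exact_mod_cast h.one_le_n
  have hN : (1 : ℝ) ≤ N := by exact_mod_cast h.one_le_n.trans h.n_le
  have hm : 1 ≤ n / δ := by rw [le_div_iff₀ hδ]; linarith
  have hS : N ≤ N * √φ / √ξ := by
    rw [le_div_iff₀ (Real.sqrt_pos.mpr hξ)]
    exact mul_le_mul_of_nonneg_left (Real.sqrt_le_sqrt h.xi_le) (by linarith)
  refine le_trans ?_ (total_time_le (K := K) hS hN hm hl)
  set T := Real.logb 2 (8 * φ / ξ) with hTdef
  have hTl : Real.log (8 * φ / ξ) / Real.log 2 = T := rfl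
  rw [hTl]
  have hδT : 0 < δ / T := div_pos hδ (by linarith)
  have hδT' : δ / T ≤ 1 / 2 := by
    rw [div_le_iff₀ (by linarith)]; linarith
  have hsqrt : √(ξ / 4) = √ξ / 2 := by
    rw [Real.sqrt_div hξ.le, show (4 : ℝ) = 2 ^ 2 by norm_num, Real.sqrt_sq (by norm_num)]
  have hlog : 0 ≤ Real.log (n / δ * T) := Real.log_nonneg (by nlinarith)
  have hS0 : 0 ≤ N * √φ / √ξ := by linarith
  set R := |K| * (2 * (N * √φ / √ξ) * Real.log (n / δ * T)) with hR
  have hR0 : 0 ≤ R := by positivity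
  have hcall : K * (N * √φ / √(ξ / 4) * Real.log (n / (δ / T))) ≤ R := by
    have e1 : N * √φ / √(ξ / 4) = 2 * (N * √φ / √ξ) := by
      rw [hsqrt]; field_simp
    have e2 : (n : ℝ) / (δ / T) = n / δ * T := by field_simp
    rw [e1, e2, hR]
    exact mul_le_mul_of_nonneg_right (le_abs_self K) (by positivity)
  have hloop := h.psdPencilLoop_time_le hO hδT hδT' hcall ⌊T⌋₊ le_rfl zero_le_one le_rfl ω
  have htime : ((psdPencil O A B ξ φ δ ω).time : ℝ) =
      5 + ((psdPencilLoop O A B ξ φ δ T ⌊T⌋₊ 0 1 ω).time : ℝ) := by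
    simp only [psdPencil, Timed.time_bind, time_charge, val_charge, ← hTdef]
    push_cast
    rfl
  have hfloor := Nat.floor_le (show 0 ≤ T by linarith)
  have h1 : (⌊T⌋₊ : ℝ) * (R + 21 * N) ≤ T * (R + 21 * N) :=
    mul_le_mul_of_nonneg_right hfloor (by linarith)
  have h2 : 3 ≤ T * N := by nlinarith
  rw [htime]
  linarith

end Guarantees
end GTRS

theorem mainTheorem3 :
    (∃ K : ℝ, GTRS.IsApproxMinEV GTRS.approxMinEV K) ∧
    ∀ K : ℝ, ∃ c : ℝ, 0 < c ∧
      ∀ O : GTRS.EVProcedure, GTRS.IsApproxMinEV O K →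
      ∀ (n : ℕ) (A B : Matrix (Fin n) (Fin n) ℝ) (a b : EuclideanSpace ℝ (Fin n))
        (d ρA ρB ξ δ φ : ℝ) (N : ℕ),
        GTRS.StandingAssumption A B ρA ρB ξ →
        φ = ρA + ρB + ‖a‖ + ‖b‖ + |d| + 1 →
        N = GTRS.nnz A + GTRS.nnz B →
        0 < δ → δ < 1 →
          (∀ ω : ℕ → O.Seed n,
            ((GTRS.psdPencil O A B ξ φ δ ω).val.calls : ℝ) ≤ Real.logb 2 (8 * φ / ξ)) ∧
          (ENNReal.ofReal (1 - δ) ≤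
            MeasureTheory.Measure.infinitePi (fun _ : ℕ => O.law n)
              {ω : ℕ → O.Seed n | ∃ (μ lam : ℝ) (x : Fin n → ℝ),
                (GTRS.psdPencil O A B ξ φ δ ω).val.out = some (μ, lam, x) ∧
                0 < μ ∧ μ ≤ 1 ∧ x ⬝ᵥ x = 1 ∧
                lam = x ⬝ᵥ ((μ • A + (1 - μ) • B) *ᵥ x) ∧
                3 * ξ / 4 ≤ lam ∧
                lam - ξ / 4 ≤ GTRS.lambdaMin (μ • A + (1 - μ) • B)}) ∧
          (∀ ω : ℕ → O.Seed n,
            ((GTRS.psdPencil O A B ξ φ δ ω).time : ℝ) ≤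
              c * (N * √φ / √ξ * Real.log (n / δ * Real.log (8 * φ / ξ)) *
                Real.log (8 * φ / ξ))) ∧
          (ξ ≤ 1 / 4 → ∀ ω : ℕ → O.Seed n,
            ((GTRS.psdPencil O A B ξ φ δ ω).time : ℝ) ≤
              c * (1 + Real.log φ) ^ 2 *
                (N * √φ / √ξ * Real.log (n / δ * Real.log (1 / ξ)) * Real.log (1 / ξ))) := by
  refine ⟨⟨5472, GTRS.isApproxMinEV_approxMinEV⟩, fun K => ?_⟩
  have hK := abs_nonneg K
  refine ⟨18 * (8 * |K| + 92), by linarith, ?_⟩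
  intro O hO n A B a b d ρA ρB ξ δ φ N hAB hφ hN hδ hδ'
  have ha := norm_nonneg a
  have hb := norm_nonneg b
  have hd := abs_nonneg d
  obtain ⟨ν, h⟩ := hAB.pencilBounds (φ := φ) (N := N) (by linarith) hN
  have hA : 0 ≤ GTRS.opNorm A := norm_nonneg _
  have hB : 0 ≤ GTRS.opNorm B := norm_nonneg _
  have hφ1 : 1 ≤ φ := by linarith [hAB.normA_le, hAB.normB_le]
  have hm : 1 ≤ n / δ := by
    have hn : (1 : ℝ) ≤ n := by exact_mod_cast h.one_le_n
    rw [le_div_iff₀ hδ]; linarith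
  have hl := h.two_le_log.1
  have hX : 0 ≤ Real.log (n / δ * Real.log (8 * φ / ξ)) := Real.log_nonneg (by nlinarith)
  refine ⟨fun ω => h.psdPencil_calls_le ω, h.psdPencil_prob hO hδ hδ', fun ω => ?_,
    fun hξ ω => ?_⟩
  · refine (h.psdPencil_time_le hO hδ hδ' ω).trans ?_
    gcongr
    linarith
  · refine (h.psdPencil_time_le hO hδ hδ' ω).trans ?_
    have hlog := mul_le_mul_of_nonneg_left (GTRS.log_mul_log_le hm hφ1 h.xi_pos hξ)
      (show 0 ≤ (8 * |K| + 92) * (N * √φ / √ξ) by positivity)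
    linarith
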